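/- Let $B$ be a real separable Banach space which is $r$-smooth for some $r\in(1,2]$, i.e. $B$ has an equivalent norm $\|\cdot\|'$ with $$\sup_{t>0}\ t^{-r}\sup\bigl\{\|x+ty\|'+\|x-ty\|'-2:\ \|x\|'=\|y\|'=1\bigr\}<\infty .$$ Let $p\in(1,2)$ with $p<r$. On a probability space let $(\rho_n)_{n\in\mathbb Z}$ be an i.i.d. sequence of random elements of the space $\mathcal L(B)$ of bounded linear operators on $B$ (measurable for the Borel $\sigma$-algebra of the operator norm) with $\mathbf E\|\rho_0\|^p<1$, and let $(\varepsilon_n)_{n\in\mathbb Z}$ be an i.i.d. sequence of $B$-valued random variables with $\mathbf E\,\varepsilon_0=0$ and $\mathbf E\|\varepsilon_0\|^p<\infty$, the two sequences being independent of each other. Let $\mu\in B$ and let $(X_n)_{n\in\mathbb Z}$ be a strictly stationary sequence of $B$-valued random variables such that, for every $n\in\mathbb Z$, almost surely $$X_n-\mu=\rho_n(X_{n-1}-\mu)+\varepsilon_n .$$ Put $S_k=X_1+\dots+X_k$. Then for every real $\alpha$ with $1\le 1/\alpha\le p$ and every $\delta>0$, $$\sum_{n=1}^{\infty} n^{\alpha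 p-2}\,\mathbf P\Bigl(\max_{1\le k\le n}\|S_k-k\mu\|\ge \delta n^{\alpha}\Bigr)<\infty .$$ In particular, if $\mu=0$, this holds with $S_k$ in place of $S_k-k\mu$. -/

import Mathlib

open MeasureTheory ProbabilityTheory

namespace BRCA

/-- A (real) Banach space `B` is `r`-smooth, `1 < r ≤ 2`, if it carries an equivalent norm `N` with
`sup_{t > 0} t⁻ʳ sup {N (x + t y) + N (x - t y) - 2 : N x = N y = 1} < ∞`.
The lower bound `c * ‖x‖ ≤ N x` makes the seminorm `N` a norm; the finiteness of the supremum is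
written as the existence of an upper bound `K`. -/
def IsRSmooth (r : ℝ) (B : Type*) [NormedAddCommGroup B] [NormedSpace ℝ B] : Prop :=
  1 < r ∧ r ≤ 2 ∧ ∃ N : Seminorm ℝ B,
    (∃ c > (0 : ℝ), ∃ C > (0 : ℝ), ∀ x : B, c * ‖x‖ ≤ N x ∧ N x ≤ C * ‖x‖) ∧
    ∃ K : ℝ, ∀ t : ℝ, 0 < t → ∀ x y : B, N x = 1 → N y = 1 →
      N (x + t • y) + N (x - t • y) - 2 ≤ K * t ^ r

/-- A two-sided sequence of independent, identically distributed random elements of `E`. -/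
structure IsIID {Ω E : Type*} [MeasurableSpace Ω] [MeasurableSpace E]
    (P : Measure Ω) (Y : ℤ → Ω → E) : Prop where
  measurable : ∀ n, Measurable (Y n)
  indep : iIndepFun Y P
  identDistrib : ∀ n, IdentDistrib (Y n) (Y 0) P P

/-- Strict stationarity: every time shift of the sequence has the same law on `ℤ → E`. -/
def IsStrictlyStationary {Ω E : Type*} [MeasurableSpace Ω] [MeasurableSpace E]
    (P : Measure Ω) (X : ℤ → Ω → E) : Prop :=
  ∀ k : ℤ, IdentDistrib (fun ω (n : ℤ) => X (n + k) ω) (fun ω (n : ℤ) => X n ω) P P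

section

variable {Ω B : Type*} [MeasurableSpace Ω] [NormedAddCommGroup B] [NormedSpace ℝ B]
  [MeasurableSpace B]

/-- The random operators are i.i.d. (measurable for the Borel `σ`-algebra of the
operator norm, which is Mathlib's `σ`-algebra on `B →L[ℝ] B`) with `E ‖ρ n‖ ^ p < ∞`. -/
structure IIDCoeffLp (P : Measure Ω) (p : ℝ) (ρ : ℤ → Ω → (B →L[ℝ] B)) : Prop where
  iid : IsIID P ρ
  integrable : ∀ n, Integrable (fun ω => ‖ρ n ω‖ ^ p) P

/-- The coefficient and innovation sequences are independent of each other. -/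
def CoeffIndepNoise (P : Measure Ω) (ρ : ℤ → Ω → (B →L[ℝ] B)) (ε : ℤ → Ω → B) : Prop :=
  IndepFun (fun ω (n : ℤ) => ρ n ω) (fun ω (n : ℤ) => ε n ω) P

/-- Contraction in the `p`-th mean: `E ‖ρ 0‖ ^ p < 1`. It is used together with `IIDCoeffLp`, which provides the
integrability. -/
def CoeffContractive (P : Measure Ω) (p : ℝ) (ρ : ℤ → Ω → (B →L[ℝ] B)) : Prop :=
  ∫ ω, ‖ρ 0 ω‖ ^ p ∂P < 1

/-- `X` is a `B`-valued random coefficient autoregressive process of order 1: a sequence of random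
variables with `X n - μ = ρ n (X (n - 1) - μ) + ε n` almost surely, for all `n : ℤ`. -/
structure IsBRCA1 (P : Measure Ω) (μ : B) (ρ : ℤ → Ω → (B →L[ℝ] B)) (ε X : ℤ → Ω → B) : Prop where
  measurable : ∀ n, Measurable (X n)
  recursion : ∀ n : ℤ, ∀ᵐ ω ∂P, X n ω - μ = ρ n ω (X (n - 1) ω - μ) + ε n ω

end

/-- `S k = X 1 + ⋯ + X k`. -/
def partialSum {Ω B : Type*} [NormedAddCommGroup B] (X : ℤ → Ω → B) (k : ℕ) (ω : Ω) : B :=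
  ∑ i ∈ Finset.Icc 1 k, X (i : ℤ) ω

/-- `max_{1 ≤ k ≤ n} ‖S k - k μ‖` for `n ≥ 1`; the maximum is taken in the nonnegative reals. -/
noncomputable def maxNormPartialSum {Ω B : Type*} [NormedAddCommGroup B] [NormedSpace ℝ B]
    (X : ℤ → Ω → B) (μ : B) (n : ℕ) (ω : Ω) : ℝ :=
  ((Finset.Icc 1 n).sup fun k => ‖partialSum X k ω - (k : ℝ) • μ‖₊ : NNReal)

end BRCA

/-!
Write `Z n = X n - μ`, and let `A` be the mean of `ρ 0`, a bounded operator with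
`‖A‖ ≤ E ‖ρ 0‖ ≤ (E ‖ρ 0‖ ^ p) ^ (1 / p) < 1`. The variables `D n = Z (n + 1) - A (Z n)` are
martingale differences for the filtration generated by the past of `(ρ, ε)`, and summation by parts
bounds `(1 - ‖A‖) ‖S k - k μ‖` by the norm of the `k`-th partial sum of `D` plus `‖Z 0‖ + ‖Z k‖`
(`one_sub_norm_mul_norm_sum_le`). So no series expansion of the process enters the sums; what is
needed is a Baum–Katz theorem for `D` and the tail sum of `‖Z 0‖`.

* That `Z n` is measurable with respect to the past is not assumed: it holds because the iterates of
  the recursion started from `0` at time `n - k` converge to `Z n` in probability as `k → ∞`. The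
  error is at most a product of `k` independent operator norms, whose mean decays geometrically,
  times `‖Z (n - k)‖`, whose law does not depend on `k`. The iterates are bounded in `L^p`, so `Z n`
  is in `L^p` by Fatou's lemma (`exists_causal_version`). The martingale property follows from the
  freezing lemma `condExp_apply_eq`.
* Smoothness gives `N (x + y) ^ r + N (x - y) ^ r ≤ 2 * N x ^ r + K * N y ^ r` for an equivalent norm
  `N` (`IsRSmooth.exists_two_point`). Together with the conditional Jensen inequality this bounds the
  `r`-th moment of a martingale by the sum of those of its increments
  (`integral_seminorm_martingale_rpow_le`), and Doob's inequality controls the maximum.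
* For the Baum–Katz theorem (`summable_measureReal_max_martingale`) the differences are truncated at
  `n ^ α` and recentred. The small parts contribute their `r`-th moments, the large parts their first
  moments, and for both the weighted sum over `n` is at most a constant times `E ‖D 0‖ ^ p`, because
  `1 < p < r`.
-/

namespace BRCA

open Filter Topology

/-! ### Two-point inequality in smooth spaces -/

lemma one_add_rpow_le {r u : ℝ} (hr1 : 1 ≤ r) (hr2 : r ≤ 2) (hu : -1 ≤ u) :
    (1 + u) ^ r ≤ 1 + r * u + 4 * |u| ^ r := by
  rcases le_or_gt |u| 1 with h | h
  · have h0 : 0 ≤ 1 + u := by linarith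
    have h1 : (1 + u) ^ r = (1 + u) * (1 + u) ^ (r - 1) := by
      rcases h0.eq_or_lt with h0 | h0
      · rw [← h0, Real.zero_rpow (by linarith), zero_mul]
      · rw [Real.rpow_sub h0, Real.rpow_one]; field_simp
    have h2 : (1 + u) ^ (r - 1) ≤ 1 + (r - 1) * u :=
      rpow_one_add_le_one_add_mul_self hu (by linarith) (by linarith)
    have h3 : u ^ 2 ≤ |u| ^ r := by
      rw [← sq_abs, ← Real.rpow_two]
      rcases (abs_nonneg u).eq_or_lt with h4 | h4
      · rw [← h4, Real.zero_rpow (by linarith : r ≠ 0), Real.zero_rpow (by norm_num)]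
      · exact Real.rpow_le_rpow_of_exponent_ge h4 h hr2
    have h4 : (0 : ℝ) ≤ |u| ^ r := by positivity
    rw [h1]
    nlinarith [mul_le_mul_of_nonneg_left h2 h0, sq_nonneg u]
  · have h0 : 1 ≤ u := by
      rcases lt_abs.1 h with h | h
      · exact h.le
      · linarith
    rw [abs_of_nonneg (by linarith)]
    have h1 : (1 + u) ^ r ≤ (2 * u) ^ r :=
      Real.rpow_le_rpow (by linarith) (by linarith) (by linarith)
    rw [Real.mul_rpow (by norm_num) (by linarith)] at h1
    have h2 : (2 : ℝ) ^ r ≤ 2 ^ (2 : ℝ) := Real.rpow_le_rpow_of_exponent_le (by norm_num) hr2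
    have h3 : (0 : ℝ) ≤ u ^ r := Real.rpow_nonneg (by linarith) _
    norm_num at h2
    nlinarith

/-- In an `r`-smooth space the norm `N` satisfies a two-point inequality of Clarkson type, which
replaces the parallelogram law. -/
lemma IsRSmooth.exists_two_point {r : ℝ} {B : Type*} [NormedAddCommGroup B] [NormedSpace ℝ B]
    (h : IsRSmooth r B) :
    ∃ N : Seminorm ℝ B, ∃ c > (0 : ℝ), ∃ C > (0 : ℝ), (∀ x, c * ‖x‖ ≤ N x ∧ N x ≤ C * ‖x‖) ∧
      ∃ K > (0 : ℝ), ∀ x y, N (x + y) ^ r + N (x - y) ^ r ≤ 2 * N x ^ r + K * N y ^ r := by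
  obtain ⟨hr1, hr2, N, ⟨c, hc, C, hC, hN⟩, K, hK⟩ := h
  have hr0 : 0 < r := by linarith
  have hpos : ∀ x, x ≠ 0 → 0 < N x := fun x hx =>
    lt_of_lt_of_le (mul_pos hc (norm_pos_iff.2 hx)) (hN x).1
  refine ⟨N, c, hc, C, hC, hN, r * |K| + 8, by positivity, fun x y => ?_⟩
  have hyr : 0 ≤ N y ^ r := Real.rpow_nonneg (apply_nonneg N y) _
  by_cases hy : y = 0
  · subst hy; simp [Real.zero_rpow hr0.ne']; linarith
  by_cases hx : x = 0
  · subst hx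
    simp only [zero_add, zero_sub, map_neg_eq_map, map_zero, Real.zero_rpow hr0.ne']
    have : 0 ≤ r * |K| * N y ^ r := by positivity
    nlinarith
  have hx' := hpos x hx
  have hy' := hpos y hy
  -- the case `N x = 1`, to which the general one reduces by homogeneity
  have key : ∀ x y : B, N x = 1 → y ≠ 0 →
      N (x + y) ^ r + N (x - y) ^ r ≤ 2 + (r * |K| + 8) * N y ^ r := by
    intro x y hx hy
    have hy' := hpos y hy
    have h1 := hK (N y) hy' x ((N y)⁻¹ • y) hx (by
      rw [map_smul_eq_mul, Real.norm_eq_abs, abs_of_pos (inv_pos.2 hy')]; field_simp)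
    rw [smul_inv_smul₀ hy'.ne'] at h1
    have h2 : |N (x + y) - 1| ≤ N y := by
      rw [← hx]; simpa using abs_sub_map_le_sub N (x + y) x
    have h3 : |N (x - y) - 1| ≤ N y := by
      rw [← hx]; simpa [map_neg_eq_map] using abs_sub_map_le_sub N (x - y) x
    have h4 := one_add_rpow_le hr1.le hr2 (u := N (x + y) - 1)
      (by linarith [apply_nonneg N (x + y)])
    have h5 := one_add_rpow_le hr1.le hr2 (u := N (x - y) - 1)
      (by linarith [apply_nonneg N (x - y)])
    have h6 := Real.rpow_le_rpow (abs_nonneg _) h2 hr0.le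
    have h7 := Real.rpow_le_rpow (abs_nonneg _) h3 hr0.le
    have h8 : K * N y ^ r ≤ |K| * N y ^ r :=
      mul_le_mul_of_nonneg_right (le_abs_self K) (by positivity)
    rw [add_sub_cancel] at h4 h5
    nlinarith
  have h1 := key ((N x)⁻¹ • x) ((N x)⁻¹ • y) (by
      rw [map_smul_eq_mul, Real.norm_eq_abs, abs_of_pos (inv_pos.2 hx')]; field_simp)
      (smul_ne_zero (inv_ne_zero hx'.ne') hy)
  rw [← smul_add, ← smul_sub] at h1
  simp only [map_smul_eq_mul, Real.norm_eq_abs, abs_of_pos (inv_pos.2 hx')] at h1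
  rw [Real.mul_rpow (by positivity) (apply_nonneg N _), Real.mul_rpow (by positivity)
    (apply_nonneg N _), Real.mul_rpow (by positivity) (apply_nonneg N _),
    Real.inv_rpow hx'.le] at h1
  have h9 : 0 < N x ^ r := by positivity
  have := mul_le_mul_of_nonneg_left h1 h9.le
  field_simp at this
  linarith

/-! ### Power sums -/

/-- Telescoping: `β * n ^ (β - 1) ≤ n ^ β - (n - 1) ^ β` by Bernoulli's inequality. -/
lemma sum_range_rpow_sub_one_le {β : ℝ} (hβ0 : 0 < β) (hβ1 : β ≤ 1) (K : ℕ) :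
    ∑ n ∈ Finset.range K, ((n + 1 : ℕ) : ℝ) ^ (β - 1) ≤ β⁻¹ * (K : ℝ) ^ β := by
  induction K with
  | zero => simp [Real.zero_rpow hβ0.ne']
  | succ K ih =>
    rw [Finset.sum_range_succ]
    set x : ℝ := ((K + 1 : ℕ) : ℝ) with hx
    have hx0 : 0 < x := by positivity
    have hK : (K : ℝ) = x * (1 + -1 / x) := by rw [hx]; push_cast; field_simp; ring
    have hx1 : 1 ≤ x := by rw [hx]; push_cast; linarith [Nat.cast_nonneg (α := ℝ) K]
    have hs : -1 ≤ -1 / x := by rw [le_div_iff₀ hx0]; linarith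
    have h1 := rpow_one_add_le_one_add_mul_self hs hβ0.le hβ1
    have h2 : (K : ℝ) ^ β ≤ x ^ β - β * x ^ (β - 1) := by
      rw [hK, Real.mul_rpow hx0.le (by linarith)]
      calc x ^ β * (1 + -1 / x) ^ β ≤ x ^ β * (1 + β * (-1 / x)) := by gcongr
        _ = _ := by rw [Real.rpow_sub_one hx0.ne']; ring
    have h3 := mul_le_mul_of_nonneg_left h2 (inv_pos.2 hβ0).le
    rw [mul_sub, inv_mul_cancel_left₀ hβ0.ne'] at h3
    linarith

/-- Telescoping: `n ^ (-γ) - (n + 1) ^ (-γ)` dominates `γ / 4 * n ^ (-γ - 1)` by Bernoulli's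
inequality. -/
lemma sum_Ico_rpow_neg_le {γ : ℝ} (hγ0 : 0 < γ) (hγ1 : γ ≤ 1) {K N : ℕ} (hKN : K ≤ N) :
    ∑ n ∈ Finset.Ico K N, ((n + 1 : ℕ) : ℝ) ^ (-γ - 1) ≤
      4 / γ * (((K + 1 : ℕ) : ℝ) ^ (-γ) - ((N + 1 : ℕ) : ℝ) ^ (-γ)) := by
  induction N, hKN using Nat.le_induction with
  | base => simp
  | succ N hN ih =>
    rw [Finset.sum_Ico_succ_top hN]
    set x : ℝ := ((N + 1 : ℕ) : ℝ) with hx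
    have hx1 : 1 ≤ x := by rw [hx]; push_cast; linarith [Nat.cast_nonneg (α := ℝ) N]
    have hx0 : 0 < x := by positivity
    have hy : ((N + 1 + 1 : ℕ) : ℝ) = x + 1 := by rw [hx]; push_cast; ring
    rw [hy]
    have hy0 : 0 < x + 1 := by linarith
    have hs : -1 ≤ -1 / (x + 1) := by rw [le_div_iff₀ hy0]; linarith
    have h1 := rpow_one_add_le_one_add_mul_self hs hγ0.le hγ1
    have hxe : x = (x + 1) * (1 + -1 / (x + 1)) := by field_simp; ring
    have h2 : x ^ γ ≤ (x + 1) ^ γ * (1 - γ / (x + 1)) := by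
      conv_lhs => rw [hxe]
      rw [Real.mul_rpow hy0.le (by linarith)]
      calc _ ≤ (x + 1) ^ γ * (1 + γ * (-1 / (x + 1))) := by gcongr
        _ = _ := by ring
    -- `x ^ (-γ) - (x + 1) ^ (-γ) ≥ γ / (x + 1) * x ^ (-γ)`
    have h3 : (x + 1) ^ (-γ) ≤ x ^ (-γ) * (1 - γ / (x + 1)) := by
      rw [Real.rpow_neg hy0.le, Real.rpow_neg hx0.le]
      have ha : 0 < x ^ γ := by positivity
      have hb : 0 < (x + 1) ^ γ := by positivity
      rw [inv_mul_eq_div, le_div_iff₀ ha, inv_mul_le_iff₀ hb]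
      exact h2
    have h4 : x ^ (-γ - 1) ≤ 4 / γ * (x ^ (-γ) * (γ / (x + 1))) := by
      rw [Real.rpow_sub_one hx0.ne']
      have : 4 / γ * (x ^ (-γ) * (γ / (x + 1))) = x ^ (-γ) * (4 / (x + 1)) := by
        field_simp
      rw [this, div_eq_mul_one_div]
      gcongr ?_ * ?_
      rw [div_le_div_iff₀ hx0 hy0]; linarith
    have h5 : 4 / γ * (x ^ (-γ) * (γ / (x + 1))) ≤ 4 / γ * (x ^ (-γ) - (x + 1) ^ (-γ)) := by
      gcongr
      linarith
    nlinarith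

/-- The weights of those `n` with `c * n ^ α ≤ m` add up to the order of `m ^ (p - 1)`, so the sum is
at most a constant times `m ^ p`. The shift `n + 1` lets the sum start at one. -/
lemma sum_mul_indicator_large_le {α p c : ℝ} (hα0 : 0 < α) (hα1 : α ≤ 1) (hp1 : 1 < p)
    (hp2 : p ≤ 2) (hc : 0 < c) {m : ℝ} (hm : 0 ≤ m) (N : ℕ) :
    ∑ n ∈ Finset.range N, ((n + 1 : ℕ) : ℝ) ^ (α * p - 1 - α) *
      (if c * ((n + 1 : ℕ) : ℝ) ^ α ≤ m then m else 0) ≤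
      ((α * (p - 1))⁻¹ * c ^ (1 - p)) * m ^ p := by
  set β := α * (p - 1) with hβ
  have hβ0 : 0 < β := mul_pos hα0 (by linarith)
  have hβ1 : β ≤ 1 := by rw [hβ]; nlinarith
  rcases hm.eq_or_lt with rfl | hm
  · simp [Real.zero_rpow (by linarith : p ≠ 0)]
  have hx0 : 0 ≤ m / c := by positivity
  have e1 : α * p - 1 - α = β - 1 := by rw [hβ]; ring
  rw [e1]
  simp only [mul_ite, mul_zero]
  rw [← Finset.sum_filter, ← Finset.sum_mul]
  have hsub : (Finset.range N).filter (fun n => c * ((n + 1 : ℕ) : ℝ) ^ α ≤ m) ⊆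
      Finset.range ⌊(m / c) ^ α⁻¹⌋₊ := by
    intro n hn
    rw [Finset.mem_filter] at hn
    rw [Finset.mem_range, ← Nat.add_one_le_iff, Nat.le_floor_iff (by positivity)]
    rw [Real.le_rpow_inv_iff_of_pos (by positivity) hx0 hα0, le_div_iff₀ hc]
    linarith [hn.2]
  calc _ ≤ (∑ n ∈ Finset.range ⌊(m / c) ^ α⁻¹⌋₊, ((n + 1 : ℕ) : ℝ) ^ (β - 1)) * m := by
        gcongr
    _ ≤ (β⁻¹ * (⌊(m / c) ^ α⁻¹⌋₊ : ℝ) ^ β) * m := by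
        gcongr; exact sum_range_rpow_sub_one_le hβ0 hβ1 _
    _ ≤ (β⁻¹ * ((m / c) ^ α⁻¹) ^ β) * m := by
        gcongr; exact Nat.floor_le (by positivity)
    _ = _ := by
        rw [← Real.rpow_mul hx0, hβ, inv_mul_cancel_left₀ hα0.ne', Real.div_rpow hm.le hc.le,
          Real.rpow_sub_one hm.ne', show (1 - p) = -(p - 1) by ring, Real.rpow_neg hc.le]
        field_simp

/-- The weights of those `n` with `m < n ^ α` add up to the order of `m ^ (p - r)`, so the sum is at
most a constant times `m ^ p`. -/
lemma sum_mul_indicator_small_le {α p r : ℝ} (hα0 : 0 < α) (hα1 : α ≤ 1) (hp1 : 1 < p)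
    (hpr : p < r) (hr2 : r ≤ 2) {m : ℝ} (hm : 0 ≤ m) (N : ℕ) :
    ∑ n ∈ Finset.range N, ((n + 1 : ℕ) : ℝ) ^ (α * p - 1 - α * r) *
      (if m < ((n + 1 : ℕ) : ℝ) ^ α then m ^ r else 0) ≤ (4 / (α * (r - p))) * m ^ p := by
  set γ := α * (r - p) with hγ
  have hγ0 : 0 < γ := mul_pos hα0 (by linarith)
  have hγ1 : γ ≤ 1 := by rw [hγ]; nlinarith
  rcases hm.eq_or_lt with rfl | hm
  · simp [Real.zero_rpow (by linarith : p ≠ 0), Real.zero_rpow (by linarith : r ≠ 0)]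
  have e1 : α * p - 1 - α * r = -γ - 1 := by rw [hγ]; ring
  rw [e1]
  simp only [mul_ite, mul_zero]
  rw [← Finset.sum_filter, ← Finset.sum_mul]
  set x := m ^ α⁻¹ with hx
  have hx0 : 0 < x := by positivity
  obtain ⟨K, hK⟩ : ∃ K : ℕ, ⌈x⌉₊ = K + 1 :=
    Nat.exists_eq_succ_of_ne_zero (Nat.ceil_pos.2 hx0).ne'
  have hsub : (Finset.range N).filter (fun n => m < ((n + 1 : ℕ) : ℝ) ^ α) ⊆
      Finset.Ico K (max K N) := by
    intro n hn
    rw [Finset.mem_filter, Finset.mem_range] at hn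
    rw [Finset.mem_Ico]
    refine ⟨?_, lt_of_lt_of_le hn.1 (le_max_right _ _)⟩
    have h1 : x ≤ ((n + 1 : ℕ) : ℝ) := by
      rw [hx, Real.rpow_inv_le_iff_of_pos hm.le (by positivity) hα0]; exact hn.2.le
    have := Nat.ceil_le.2 h1
    omega
  have hxK : x ≤ ((K + 1 : ℕ) : ℝ) := hK ▸ Nat.le_ceil x
  calc _ ≤ (∑ n ∈ Finset.Ico K (max K N), ((n + 1 : ℕ) : ℝ) ^ (-γ - 1)) * m ^ r := by
        gcongr
    _ ≤ (4 / γ * (((K + 1 : ℕ) : ℝ) ^ (-γ) - ((max K N + 1 : ℕ) : ℝ) ^ (-γ))) * m ^ r := by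
        gcongr; exact sum_Ico_rpow_neg_le hγ0 hγ1 (le_max_left _ _)
    _ ≤ (4 / γ * x ^ (-γ)) * m ^ r := by
        have h1 : (0 : ℝ) ≤ ((max K N + 1 : ℕ) : ℝ) ^ (-γ) := by positivity
        have h2 : ((K + 1 : ℕ) : ℝ) ^ (-γ) ≤ x ^ (-γ) :=
          Real.rpow_le_rpow_of_nonpos hx0 hxK (by linarith)
        gcongr
        linarith
    _ = _ := by
        rw [hx, ← Real.rpow_mul hm.le, mul_assoc, ← Real.rpow_add hm, hγ]
        congr 2
        field_simp
        ring

/-! ### Martingales in smooth spaces -/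

section Martingale

variable {Ω B : Type*} {m0 : MeasurableSpace Ω} {P : Measure Ω}
  [NormedAddCommGroup B] [NormedSpace ℝ B] {N : Seminorm ℝ B} {C r : ℝ}

lemma continuous_seminorm_of_le (hN : ∀ x, N x ≤ C * ‖x‖) : Continuous N := by
  refine (LipschitzWith.of_dist_le_mul (K := C.toNNReal) fun x y => ?_).continuous
  rw [Real.dist_eq, dist_eq_norm]
  refine (abs_sub_map_le_sub N x y).trans ((hN _).trans ?_)
  gcongr
  exact Real.le_coe_toNNReal C

lemma integrable_seminorm_rpow (hN : ∀ x, N x ≤ C * ‖x‖) (hr : 0 < r) {f : Ω → B}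
    (hf : MemLp f (ENNReal.ofReal r) P) : Integrable (fun ω => N (f ω) ^ r) P := by
  have h1 := hf.integrable_norm_rpow (by simpa using hr) (by simp)
  rw [ENNReal.toReal_ofReal hr.le] at h1
  refine (h1.const_mul (C ^ r)).mono' ?_ (.of_forall fun ω => ?_)
  · have : Continuous fun x : B => N x ^ r :=
      (continuous_seminorm_of_le hN).rpow_const fun _ => Or.inr hr.le
    exact this.comp_aestronglyMeasurable hf.1
  · have h0 := apply_nonneg N (f ω)
    rw [Real.norm_of_nonneg (by positivity)]
    by_cases hz : ‖f ω‖ = 0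
    · have : N (f ω) = 0 := le_antisymm (by simpa [hz] using hN (f ω)) h0
      rw [this, hz, Real.zero_rpow hr.ne', mul_zero]
    · have : 0 ≤ C := by
        have := h0.trans (hN (f ω))
        exact nonneg_of_mul_nonneg_left this (lt_of_le_of_ne (norm_nonneg _) (Ne.symm hz))
      rw [← Real.mul_rpow this (norm_nonneg _)]
      exact Real.rpow_le_rpow h0 (hN _) hr.le

variable [IsProbabilityMeasure P] [CompleteSpace B]

/-- Conditional Jensen inequality for the convex function `N ^ r`. -/
lemma seminorm_condExp_rpow_le (hN : ∀ x, N x ≤ C * ‖x‖) (hr : 1 ≤ r) {m : MeasurableSpace Ω}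
    (hm : m ≤ m0) {f : Ω → B} (hf : MemLp f (ENNReal.ofReal r) P) :
    (fun ω => N ((P[f | m]) ω) ^ r) ≤ᵐ[P] P[fun ω => N (f ω) ^ r | m] := by
  have hconv : ConvexOn ℝ Set.univ fun x : B => N x ^ r := by
    refine ⟨convex_univ, fun x _ y _ a b ha hb hab => ?_⟩
    have h1 : N (a • x + b • y) ≤ a • N x + b • N y := N.convexOn.2 trivial trivial ha hb hab
    exact (Real.rpow_le_rpow (apply_nonneg N _) h1 (by linarith)).trans
      ((convexOn_rpow hr).2 (apply_nonneg N x) (apply_nonneg N y) ha hb hab)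
  have hcont : Continuous fun x : B => N x ^ r :=
    (continuous_seminorm_of_le hN).rpow_const fun _ => Or.inr (by linarith)
  exact hconv.map_condExp_le_univ hm hcont.lowerSemicontinuous
    (hf.integrable (by simpa using hr)) (integrable_seminorm_rpow hN (by linarith) hf)

/-- One step of the moment bound: adding a martingale increment `D` to the past `S`. The two-point
inequality controls `N (S + D) ^ r + N (S - D) ^ r`, and by Jensen the second term has at least
the mean of `N S ^ r`. -/
lemma integral_seminorm_add_rpow_le (hN : ∀ x, N x ≤ C * ‖x‖) (hr : 1 ≤ r) {K : ℝ}
    (hK : ∀ x y, N (x + y) ^ r + N (x - y) ^ r ≤ 2 * N x ^ r + K * N y ^ r)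
    {m : MeasurableSpace Ω} (hm : m ≤ m0) {S D : Ω → B} (hS : StronglyMeasurable[m] S)
    (hSr : MemLp S (ENNReal.ofReal r) P) (hDr : MemLp D (ENNReal.ofReal r) P)
    (hD : P[D | m] =ᵐ[P] 0) :
    ∫ ω, N (S ω + D ω) ^ r ∂P ≤ ∫ ω, N (S ω) ^ r ∂P + K * ∫ ω, N (D ω) ^ r ∂P := by
  have hr0 : 0 < r := by linarith
  have hr1 : 1 ≤ ENNReal.ofReal r := by simpa using hr
  have i1 : Integrable (fun ω => N (S ω + D ω) ^ r) P :=
    integrable_seminorm_rpow hN hr0 (hSr.add hDr)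
  have i2 : Integrable (fun ω => N (S ω - D ω) ^ r) P :=
    integrable_seminorm_rpow hN hr0 (hSr.sub hDr)
  have i3 := integrable_seminorm_rpow hN hr0 hSr
  have i4 := integrable_seminorm_rpow hN hr0 hDr
  have h1 : ∫ ω, N (S ω) ^ r ∂P ≤ ∫ ω, N (S ω - D ω) ^ r ∂P := by
    have h2 : P[S - D | m] =ᵐ[P] S := by
      have h3 := condExp_sub (hSr.integrable hr1) (hDr.integrable hr1) m
      rw [condExp_of_stronglyMeasurable hm hS (hSr.integrable hr1)] at h3
      filter_upwards [h3, hD] with ω h3 h4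
      rw [h3]; simp [h4]
    have h4 := seminorm_condExp_rpow_le hN hr hm (hSr.sub hDr)
    calc ∫ ω, N (S ω) ^ r ∂P ≤ ∫ ω, (P[fun ω => N ((S - D) ω) ^ r | m]) ω ∂P := by
          refine integral_mono_ae i3 integrable_condExp ?_
          filter_upwards [h2, h4] with ω h2 h4
          rwa [h2] at h4
      _ = _ := integral_condExp hm
  have h2 : ∫ ω, N (S ω + D ω) ^ r ∂P + ∫ ω, N (S ω - D ω) ^ r ∂P ≤
      2 * ∫ ω, N (S ω) ^ r ∂P + K * ∫ ω, N (D ω) ^ r ∂P := by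
    rw [← integral_const_mul, ← integral_const_mul, ← integral_add (i3.const_mul 2)
      (i4.const_mul K), ← integral_add i1 i2]
    exact integral_mono (i1.add i2) ((i3.const_mul 2).add (i4.const_mul K))
      fun ω => hK (S ω) (D ω)
  linarith

/-- Assouad's moment inequality for martingales in smooth spaces. -/
lemma integral_seminorm_martingale_rpow_le (hN : ∀ x, N x ≤ C * ‖x‖) (hr : 1 ≤ r) {K : ℝ}
    (hK : ∀ x y, N (x + y) ^ r + N (x - y) ^ r ≤ 2 * N x ^ r + K * N y ^ r)
    {ℱ : Filtration ℕ m0} {T : ℕ → Ω → B} (hT : Martingale T ℱ P)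
    (hTr : ∀ n, MemLp (T n) (ENNReal.ofReal r) P) (hT0 : T 0 = 0) (n : ℕ) :
    ∫ ω, N (T n ω) ^ r ∂P ≤ K * ∑ i ∈ Finset.range n, ∫ ω, N (T (i + 1) ω - T i ω) ^ r ∂P := by
  induction n with
  | zero => simp [hT0, Real.zero_rpow (by linarith : r ≠ 0)]
  | succ n ih =>
    have hD : P[T (n + 1) - T n | ℱ n] =ᵐ[P] 0 := by
      have h3 := condExp_sub (hT.integrable (n + 1)) (hT.integrable n) (ℱ n)
      rw [condExp_of_stronglyMeasurable (ℱ.le n) (hT.1 n) (hT.integrable n)] at h3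
      filter_upwards [h3, hT.2 n (n + 1) n.le_succ] with ω h3 h4
      rw [h3]; simp [h4]
    have h := integral_seminorm_add_rpow_le hN hr hK (ℱ.le n) (hT.1 n) (hTr n)
      ((hTr (n + 1)).sub (hTr n)) hD
    simp only [Pi.sub_apply, add_sub_cancel] at h
    rw [Finset.sum_range_succ, mul_add]
    linarith

/-- Doob's maximal inequality for `N ^ r` of a martingale. -/
lemma measureReal_exists_le_seminorm_martingale (hN : ∀ x, N x ≤ C * ‖x‖) (hr : 1 ≤ r)
    {ℱ : Filtration ℕ m0} {T : ℕ → Ω → B} (hT : Martingale T ℱ P)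
    (hTr : ∀ n, MemLp (T n) (ENNReal.ofReal r) P) (n : ℕ) {l : ℝ} (hl : 0 < l) :
    P.real {ω | ∃ k ≤ n, l ≤ N (T k ω)} ≤ (l ^ r)⁻¹ * ∫ ω, N (T n ω) ^ r ∂P := by
  have hr0 : 0 < r := by linarith
  have hcont : Continuous fun x : B => N x ^ r :=
    (continuous_seminorm_of_le hN).rpow_const fun _ => Or.inr hr0.le
  have hint := fun n => integrable_seminorm_rpow hN hr0 (hTr n)
  have hsub : Submartingale (fun k ω => N (T k ω) ^ r) ℱ P := by
    refine submartingale_nat (fun k => hcont.comp_stronglyMeasurable (hT.1 k)) hint fun k => ?_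
    filter_upwards [seminorm_condExp_rpow_le hN hr (ℱ.le k) (hTr (k + 1)),
      hT.2 k (k + 1) k.le_succ] with ω h1 h2
    rwa [h2] at h1
  have hlr : 0 < l ^ r := by positivity
  have h := maximal_ineq hsub (fun k ω => Real.rpow_nonneg (apply_nonneg N _) r)
    (ε := (l ^ r).toNNReal) n
  rw [Real.coe_toNNReal _ hlr.le] at h
  have hset : {ω | ∃ k ≤ n, l ≤ N (T k ω)} = {ω | l ^ r ≤ (Finset.range (n + 1)).sup'
      Finset.nonempty_range_add_one fun k => N (T k ω) ^ r} := by
    ext ω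
    simp only [Set.mem_ofPred_eq, Finset.le_sup'_iff, Finset.mem_range, Nat.lt_succ_iff]
    exact exists_congr fun k => and_congr_right fun _ =>
      (Real.rpow_le_rpow_iff hl.le (apply_nonneg N _) hr0).symm
  rw [hset]
  set s := {ω | l ^ r ≤ (Finset.range (n + 1)).sup'
      Finset.nonempty_range_add_one fun k => N (T k ω) ^ r}
  rw [le_inv_mul_iff₀ hlr]
  have h2 := ENNReal.toReal_mono ENNReal.ofReal_ne_top h
  rw [ENNReal.toReal_mul, ENNReal.coe_toReal, Real.coe_toNNReal _ hlr.le,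
    ENNReal.toReal_ofReal (integral_nonneg fun ω => Real.rpow_nonneg (apply_nonneg N _) r)] at h2
  exact h2.trans (setIntegral_le_integral (hint n)
    (.of_forall fun ω => Real.rpow_nonneg (apply_nonneg N _) r))

end Martingale

/-! ### Truncated moments and the Baum–Katz theorem -/

section Truncation

variable {Ω : Type*} {m0 : MeasurableSpace Ω} {P : Measure Ω}

lemma summable_mul_integral_of_sum_le {w : ℕ → ℝ} {f : ℕ → Ω → ℝ} {g : Ω → ℝ}
    (hw : ∀ n, 0 ≤ w n) (hf0 : ∀ n ω, 0 ≤ f n ω) (hf : ∀ n, Integrable (f n) P)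
    (hg : Integrable g P) (h : ∀ N ω, ∑ n ∈ Finset.range N, w n * f n ω ≤ g ω) :
    Summable fun n => w n * ∫ ω, f n ω ∂P := by
  refine summable_of_sum_range_le (c := ∫ ω, g ω ∂P)
    (fun n => mul_nonneg (hw n) (integral_nonneg (hf0 n))) fun N => ?_
  simp_rw [← integral_const_mul]
  rw [← integral_finsetSum _ fun n _ => (hf n).const_mul (w n)]
  exact integral_mono (integrable_finsetSum _ fun n _ => (hf n).const_mul (w n)) hg (h N)

variable {Y : Ω → ℝ}

lemma integrable_large (hY : Measurable Y) (hYi : Integrable Y P) (c : ℝ) :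
    Integrable (fun ω => if c ≤ Y ω then Y ω else 0) P :=
  (hYi.indicator (measurableSet_le (measurable_const (a := c)) hY)).congr
    (.of_forall fun ω => by simp [Set.indicator_apply])

variable [IsProbabilityMeasure P]

lemma integrable_of_rpow {p : ℝ} (hp : 1 ≤ p) (hY : AEStronglyMeasurable Y P)
    (hY0 : ∀ ω, 0 ≤ Y ω) (hYp : Integrable (fun ω => Y ω ^ p) P) : Integrable Y P := by
  refine (hYp.add (integrable_const 1)).mono' hY (.of_forall fun ω => ?_)
  rw [Real.norm_of_nonneg (hY0 ω)]
  rcases le_total (Y ω) 1 with h | h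
  · have : 0 ≤ Y ω ^ p := Real.rpow_nonneg (hY0 ω) p
    simp only [Pi.add_apply]; linarith
  · have := Real.self_le_rpow_of_one_le h hp
    simp only [Pi.add_apply]; linarith

lemma integrable_small (hY : Measurable Y) (hY0 : ∀ ω, 0 ≤ Y ω) {r : ℝ} (hr : 0 ≤ r) (c : ℝ) :
    Integrable (fun ω => if Y ω < c then Y ω ^ r else 0) P := by
  refine Integrable.of_bound (C := |c| ^ r) (Measurable.aestronglyMeasurable <|
    Measurable.ite (measurableSet_lt hY measurable_const) (hY.pow_const r) measurable_const)
    (.of_forall fun ω => ?_)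
  split_ifs with h
  · rw [Real.norm_of_nonneg (Real.rpow_nonneg (hY0 ω) r)]
    exact Real.rpow_le_rpow (hY0 ω) (h.le.trans (le_abs_self c)) hr
  · rw [norm_zero]; positivity

lemma summable_integral_large {α p c : ℝ} (hα0 : 0 < α) (hα1 : α ≤ 1) (hp1 : 1 < p) (hp2 : p ≤ 2)
    (hc : 0 < c) (hY : Measurable Y) (hY0 : ∀ ω, 0 ≤ Y ω) (hYp : Integrable (fun ω => Y ω ^ p) P) :
    Summable fun n : ℕ => ((n + 1 : ℕ) : ℝ) ^ (α * p - 1 - α) *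
      ∫ ω, (if c * ((n + 1 : ℕ) : ℝ) ^ α ≤ Y ω then Y ω else 0) ∂P := by
  have hYi := integrable_of_rpow hp1.le hY.aestronglyMeasurable hY0 hYp
  refine summable_mul_integral_of_sum_le (fun n => by positivity) (fun n ω => ?_)
    (fun n => integrable_large hY hYi _) (hYp.const_mul ((α * (p - 1))⁻¹ * c ^ (1 - p)))
    fun N ω => sum_mul_indicator_large_le hα0 hα1 hp1 hp2 hc (hY0 ω) N
  split_ifs
  exacts [hY0 ω, le_rfl]

lemma summable_integral_small {α p r : ℝ} (hα0 : 0 < α) (hα1 : α ≤ 1) (hp1 : 1 < p) (hpr : p < r)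
    (hr2 : r ≤ 2) (hY : Measurable Y) (hY0 : ∀ ω, 0 ≤ Y ω)
    (hYp : Integrable (fun ω => Y ω ^ p) P) :
    Summable fun n : ℕ => ((n + 1 : ℕ) : ℝ) ^ (α * p - 1 - α * r) *
      ∫ ω, (if Y ω < ((n + 1 : ℕ) : ℝ) ^ α then Y ω ^ r else 0) ∂P := by
  refine summable_mul_integral_of_sum_le (fun n => by positivity) (fun n ω => ?_)
    (fun n => integrable_small hY hY0 (by linarith) _) (hYp.const_mul (4 / (α * (r - p))))
    fun N ω => sum_mul_indicator_small_le hα0 hα1 hp1 hpr hr2 (hY0 ω) N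
  split_ifs
  exacts [Real.rpow_nonneg (hY0 ω) r, le_rfl]

/-- Tail sum of a variable in `L^p`; by Markov's inequality it follows from the bound on the
truncated first moments. -/
lemma summable_measureReal_tail {α p c : ℝ} (hα0 : 0 < α) (hα1 : α ≤ 1) (hp1 : 1 < p)
    (hp2 : p ≤ 2) (hc : 0 < c) (hY : Measurable Y) (hY0 : ∀ ω, 0 ≤ Y ω)
    (hYp : Integrable (fun ω => Y ω ^ p) P) :
    Summable fun n : ℕ => ((n + 1 : ℕ) : ℝ) ^ (α * p - 1) *
      P.real {ω | c * ((n + 1 : ℕ) : ℝ) ^ α ≤ Y ω} := by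
  have hYi := integrable_of_rpow hp1.le hY.aestronglyMeasurable hY0 hYp
  refine Summable.of_nonneg_of_le (fun n => by positivity) (fun n => ?_)
    ((summable_integral_large hα0 hα1 hp1 hp2 hc hY hY0 hYp).mul_left c⁻¹)
  set x : ℝ := ((n + 1 : ℕ) : ℝ) with hx
  have hx0 : 0 < x := by positivity
  have hl : 0 < c * x ^ α := by positivity
  have h := mul_meas_ge_le_integral_of_nonneg (μ := P) (.of_forall fun ω => ?_)
    (integrable_large hY hYi (c * x ^ α)) (c * x ^ α)
  · have hs : {ω | c * x ^ α ≤ if c * x ^ α ≤ Y ω then Y ω else 0} = {ω | c * x ^ α ≤ Y ω} := by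
      ext ω
      simp only [Set.mem_ofPred_eq]
      split_ifs with h
      · rfl
      · exact iff_of_false (not_le.2 hl) h
    rw [hs] at h
    have e : x ^ (α * p - 1) = c⁻¹ * x ^ (α * p - 1 - α) * (c * x ^ α) := by
      rw [Real.rpow_sub hx0 (α * p - 1)]; field_simp
    rw [e, mul_assoc, ← mul_assoc c⁻¹ _ (∫ ω, _ ∂P)]
    exact mul_le_mul_of_nonneg_left h (by positivity)
  · simp only [Pi.zero_apply]
    split_ifs
    exacts [hY0 ω, le_rfl]

end Truncation

section BaumKatz

variable {Ω B : Type*} {m0 : MeasurableSpace Ω} {P : Measure Ω} [IsProbabilityMeasure P]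
  [NormedAddCommGroup B] [NormedSpace ℝ B] [CompleteSpace B]

/-- Maximal inequality for martingale differences in a smooth space, truncated at level `c`: the
small parts are controlled by their `r`-th moments, the large parts by their first moments. -/
lemma exists_measureReal_max_sum_le {r : ℝ} (hB : IsRSmooth r B) :
    ∃ A : ℝ, 0 ≤ A ∧ ∀ {ℱ : Filtration ℕ m0} {D : ℕ → Ω → B},
      (∀ i, StronglyMeasurable[ℱ (i + 1)] (D i)) → (∀ i, Integrable (D i) P) →
      (∀ i, P[D i | ℱ i] =ᵐ[P] 0) →
      (∀ i, IdentDistrib (fun ω => ‖D i ω‖) (fun ω => ‖D 0 ω‖) P P) →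
      ∀ (n : ℕ) {l c : ℝ}, 0 < l → 0 < c →
      P.real {ω | ∃ k ≤ n, l ≤ ‖∑ i ∈ Finset.range k, D i ω‖} ≤
        n * (A * (l ^ r)⁻¹ * ∫ ω, (if ‖D 0 ω‖ < c then ‖D 0 ω‖ ^ r else 0) ∂P +
          4 * l⁻¹ * ∫ ω, (if c ≤ ‖D 0 ω‖ then ‖D 0 ω‖ else 0) ∂P) := by
  have hr1 := hB.1
  have hr0 : 0 < r := by linarith
  have hr1' : 1 ≤ ENNReal.ofReal r := by simpa using hr1.le
  obtain ⟨N, c₀, hc₀, C, hC, hNC, K, hK0, hK⟩ := hB.exists_two_point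
  have hN : ∀ x, N x ≤ C * ‖x‖ := fun x => (hNC x).2
  refine ⟨((c₀ / 2) ^ r)⁻¹ * (K * ((2 + K) * C ^ r)), by positivity, ?_⟩
  intro ℱ D hDm hDi hD0 hDid n l c hl hc
  set I := ∫ ω, (if ‖D 0 ω‖ < c then ‖D 0 ω‖ ^ r else 0) ∂P
  set J := ∫ ω, (if c ≤ ‖D 0 ω‖ then ‖D 0 ω‖ else 0) ∂P
  set U : ℕ → Ω → B := fun i => {ω | ‖D i ω‖ < c}.indicator (D i) with hU
  set V : ℕ → Ω → B := fun i => {ω | c ≤ ‖D i ω‖}.indicator (D i) with hV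
  have hUV : ∀ i, D i = U i + V i := fun i => by
    ext ω
    simp only [hU, hV, Pi.add_apply, Set.indicator_apply, Set.mem_ofPred_eq]
    rcases lt_or_ge ‖D i ω‖ c with h | h
    · simp [h, not_le.2 h]
    · simp [h, not_lt.2 h]
  have hUm : ∀ i, StronglyMeasurable[ℱ (i + 1)] (U i) := fun i =>
    (hDm i).indicator ((hDm i).norm.measurable measurableSet_Iio)
  have hVm : ∀ i, StronglyMeasurable[ℱ (i + 1)] (V i) := fun i =>
    (hDm i).indicator ((hDm i).norm.measurable measurableSet_Ici)
  have hUbd : ∀ i ω, ‖U i ω‖ ≤ c := fun i ω => by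
    simp only [hU, Set.indicator_apply, Set.mem_ofPred_eq]
    split_ifs with h
    exacts [h.le, by simpa using hc.le]
  have hUr : ∀ i, MemLp (U i) (ENNReal.ofReal r) P := fun i =>
    MemLp.of_bound ((hUm i).mono (ℱ.le _)).aestronglyMeasurable c (.of_forall (hUbd i))
  have hUi : ∀ i, Integrable (U i) P := fun i => (hUr i).integrable hr1'
  have hVi : ∀ i, Integrable (V i) P := fun i =>
    (hDi i).indicator (((hDm i).mono (ℱ.le _)).norm.measurable measurableSet_Ici)
  have hUI : ∀ i, ∫ ω, ‖U i ω‖ ^ r ∂P = I := fun i => by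
    have hm : Measurable fun x : ℝ => if x < c then x ^ r else 0 :=
      Measurable.ite measurableSet_Iio (measurable_id.pow_const r) measurable_const
    refine Eq.trans (integral_congr_ae (.of_forall fun ω => ?_)) ((hDid i).comp hm).integral_eq
    simp only [hU, Set.indicator_apply, Set.mem_ofPred_eq, Function.comp]
    split_ifs
    exacts [rfl, by rw [norm_zero, Real.zero_rpow hr0.ne']]
  have hVJ : ∀ i, ∫ ω, ‖V i ω‖ ∂P = J := fun i => by
    have hm : Measurable fun x : ℝ => if c ≤ x then x else 0 :=
      Measurable.ite measurableSet_Ici measurable_id measurable_const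
    refine Eq.trans (integral_congr_ae (.of_forall fun ω => ?_)) ((hDid i).comp hm).integral_eq
    simp only [hV, Set.indicator_apply, Set.mem_ofPred_eq, Function.comp]
    split_ifs
    exacts [rfl, norm_zero]
  -- the centred small and large parts
  set D' : ℕ → Ω → B := fun i => U i - P[U i | ℱ i] with hD'
  set G : ℕ → Ω → B := fun i => V i - P[V i | ℱ i] with hG
  have hDG : ∀ i, D i =ᵐ[P] D' i + G i := fun i => by
    have h := condExp_add (hUi i) (hVi i) (ℱ i)
    rw [← hUV i] at h
    filter_upwards [h, hD0 i] with ω h1 h2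
    have h3 : D i ω = U i ω + V i ω := congrFun (hUV i) ω
    rw [h2] at h1
    simp only [Pi.zero_apply, Pi.add_apply] at h1
    simp only [hD', hG, Pi.add_apply, Pi.sub_apply, h3]
    rw [← sub_eq_zero]
    calc _ = (P[U i | ℱ i]) ω + (P[V i | ℱ i]) ω := by abel
      _ = 0 := h1.symm
  have hD'r : ∀ i, MemLp (D' i) (ENNReal.ofReal r) P := fun i => (hUr i).sub ((hUr i).condExp hr1')
  set T : ℕ → Ω → B := fun k => ∑ i ∈ Finset.range k, D' i with hT
  have hTr : ∀ k, MemLp (T k) (ENNReal.ofReal r) P := fun k =>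
    memLp_finsetSum' _ fun i _ => hD'r i
  have hD'm : ∀ i, StronglyMeasurable[ℱ (i + 1)] (D' i) := fun i =>
    (hUm i).sub (stronglyMeasurable_condExp.mono (ℱ.mono i.le_succ))
  have hTmart : Martingale T ℱ P := by
    refine martingale_nat (fun k => ?_) (fun k => (hTr k).integrable hr1') fun k => ?_
    · exact Finset.stronglyMeasurable_sum _ fun i hi =>
        (hD'm i).mono (ℱ.mono (Finset.mem_range.1 hi))
    · have hTk : StronglyMeasurable[ℱ k] (T k) := Finset.stronglyMeasurable_sum _ fun i hi =>
        (hD'm i).mono (ℱ.mono (Finset.mem_range.1 hi))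
      have e : T (k + 1) = T k + D' k := Finset.sum_range_succ _ _
      have h1 := condExp_add ((hTr k).integrable hr1') ((hD'r k).integrable hr1') (ℱ k)
      have h2 := condExp_sub (hUi k) (integrable_condExp (f := U k) (m := ℱ k) (μ := P)) (ℱ k)
      rw [condExp_of_stronglyMeasurable (ℱ.le k) hTk ((hTr k).integrable hr1')] at h1
      rw [condExp_of_stronglyMeasurable (ℱ.le k) stronglyMeasurable_condExp
        integrable_condExp] at h2
      rw [e]
      filter_upwards [h1, h2] with ω h1 h2
      rw [h1, Pi.add_apply, h2]; simp
  have hstep : ∀ i, ∫ ω, N (D' i ω) ^ r ∂P ≤ (2 + K) * C ^ r * I := fun i => by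
    have i1 := integrable_seminorm_rpow hN hr0 (hUr i)
    have i2 := integrable_seminorm_rpow hN hr0 ((hUr i).condExp (m := ℱ i) hr1')
    have h1 : ∫ ω, N (D' i ω) ^ r ∂P ≤
        2 * ∫ ω, N (U i ω) ^ r ∂P + K * ∫ ω, N ((P[U i | ℱ i]) ω) ^ r ∂P := by
      rw [← integral_const_mul, ← integral_const_mul,
        ← integral_add (i1.const_mul 2) (i2.const_mul K)]
      refine integral_mono (integrable_seminorm_rpow hN hr0 (hD'r i))
        ((i1.const_mul 2).add (i2.const_mul K)) fun ω => ?_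
      exact (le_add_of_nonneg_left (Real.rpow_nonneg (apply_nonneg N _) r)).trans (hK _ _)
    have h2 : ∫ ω, N ((P[U i | ℱ i]) ω) ^ r ∂P ≤ ∫ ω, N (U i ω) ^ r ∂P := by
      rw [← integral_condExp (f := fun ω => N (U i ω) ^ r) (ℱ.le i)]
      exact integral_mono_ae i2 integrable_condExp
        (seminorm_condExp_rpow_le hN hr1.le (ℱ.le i) (hUr i))
    have h3 : ∫ ω, N (U i ω) ^ r ∂P ≤ C ^ r * I := by
      rw [← hUI i, ← integral_const_mul]
      have h := (hUr i).integrable_norm_rpow (by simpa using hr0) (by simp)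
      rw [ENNReal.toReal_ofReal hr0.le] at h
      refine integral_mono i1 (h.const_mul _) fun ω => ?_
      simp only
      rw [← Real.mul_rpow hC.le (norm_nonneg _)]
      exact Real.rpow_le_rpow (apply_nonneg N _) (hN _) hr0.le
    have h4 := mul_le_mul_of_nonneg_left h2 hK0.le
    have h5 := mul_le_mul_of_nonneg_left h3 (by positivity : 0 ≤ 2 + K)
    linarith
  have hmax : P.real {ω | ∃ k ≤ n, c₀ * (l / 2) ≤ N (T k ω)} ≤
      n * (((c₀ / 2) ^ r)⁻¹ * (K * ((2 + K) * C ^ r)) * (l ^ r)⁻¹ * I) := by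
    have h1 := measureReal_exists_le_seminorm_martingale hN hr1.le hTmart hTr n
      (l := c₀ * (l / 2)) (by positivity)
    have h2 := integral_seminorm_martingale_rpow_le hN hr1.le hK hTmart hTr
      (by simp [hT]) n
    have h3 : ∑ i ∈ Finset.range n, ∫ ω, N (T (i + 1) ω - T i ω) ^ r ∂P ≤
        n * ((2 + K) * C ^ r * I) := by
      have : ∀ i, T (i + 1) = T i + D' i := fun i => Finset.sum_range_succ _ _
      simp only [this, Pi.add_apply, add_sub_cancel_left]
      exact (Finset.sum_le_sum fun i _ => hstep i).trans (by simp)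
    calc _ ≤ ((c₀ * (l / 2)) ^ r)⁻¹ * (K * (n * ((2 + K) * C ^ r * I))) := by
          refine h1.trans ?_
          gcongr
          exact h2.trans (by gcongr)
      _ = _ := by
          rw [show c₀ * (l / 2) = c₀ / 2 * l by ring, Real.mul_rpow (by positivity) hl.le, mul_inv]
          ring
  have hGi : ∀ i, Integrable (G i) P := fun i => (hVi i).sub integrable_condExp
  have hGJ : ∀ i, ∫ ω, ‖G i ω‖ ∂P ≤ 2 * J := fun i => by
    have h1 : ∫ ω, ‖G i ω‖ ∂P ≤ ∫ ω, (‖V i ω‖ + ‖(P[V i | ℱ i]) ω‖) ∂P :=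
      integral_mono (hGi i).norm ((hVi i).norm.add integrable_condExp.norm)
        fun ω => norm_sub_le _ _
    rw [integral_add (hVi i).norm integrable_condExp.norm] at h1
    have h2 := integral_norm_condExp_le (μ := P) (m := ℱ i) (V i)
    rw [hVJ] at *
    linarith
  have hlarge : P.real {ω | l / 2 ≤ ∑ i ∈ Finset.range n, ‖G i ω‖} ≤ n * (4 * l⁻¹ * J) := by
    have h1 := mul_meas_ge_le_integral_of_nonneg (μ := P)
      (f := fun ω => ∑ i ∈ Finset.range n, ‖G i ω‖)
      (.of_forall fun ω => Finset.sum_nonneg fun i _ => norm_nonneg _)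
      (integrable_finsetSum _ fun i _ => (hGi i).norm) (l / 2)
    rw [integral_finsetSum _ fun i _ => (hGi i).norm] at h1
    have h2 : ∑ i ∈ Finset.range n, ∫ ω, ‖G i ω‖ ∂P ≤ n * (2 * J) :=
      (Finset.sum_le_sum fun i _ => hGJ i).trans (by simp)
    have h3 := mul_le_mul_of_nonneg_left (h1.trans h2) (by positivity : 0 ≤ 2 * l⁻¹)
    calc _ = 2 * l⁻¹ * (l / 2 * P.real {ω | l / 2 ≤ ∑ i ∈ Finset.range n, ‖G i ω‖}) := by
          field_simp
      _ ≤ _ := h3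
      _ = _ := by ring
  have hsub : P.real {ω | ∃ k ≤ n, l ≤ ‖∑ i ∈ Finset.range k, D i ω‖} ≤
      P.real ({ω | ∃ k ≤ n, c₀ * (l / 2) ≤ N (T k ω)} ∪
        {ω | l / 2 ≤ ∑ i ∈ Finset.range n, ‖G i ω‖}) := by
    refine ENNReal.toReal_mono (measure_ne_top _ _) (measure_mono_ae ?_)
    filter_upwards [ae_all_iff.2 hDG] with ω hω
    rintro ⟨k, hk, hlk⟩
    by_contra hcon
    obtain ⟨hcon1, hcon2⟩ := not_or.1 (show ¬ ((∃ k ≤ n, c₀ * (l / 2) ≤ N (T k ω)) ∨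
      l / 2 ≤ ∑ i ∈ Finset.range n, ‖G i ω‖) from hcon)
    have h1 := not_le.1 fun h => hcon1 ⟨k, hk, h⟩
    have h2 : ‖T k ω‖ < l / 2 := lt_of_mul_lt_mul_left ((hNC _).1.trans_lt h1) hc₀.le
    have h3 : ∑ i ∈ Finset.range k, D i ω = T k ω + ∑ i ∈ Finset.range k, G i ω := by
      simp only [hT, Finset.sum_apply, ← Finset.sum_add_distrib]
      exact Finset.sum_congr rfl fun i _ => by rw [hω i]; rfl
    have h4 : ‖∑ i ∈ Finset.range k, G i ω‖ ≤ ∑ i ∈ Finset.range n, ‖G i ω‖ :=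
      (norm_sum_le _ _).trans (Finset.sum_le_sum_of_subset_of_nonneg
        (Finset.range_mono hk) fun i _ _ => norm_nonneg _)
    rw [h3] at hlk
    have h5 := hlk.trans (norm_add_le _ _)
    linarith
  calc _ ≤ _ := hsub.trans (measureReal_union_le _ _)
    _ ≤ _ := add_le_add hmax hlarge
    _ = _ := by ring

/-- Baum–Katz theorem for martingale differences in `L^p` whose norms have a common law. -/
theorem summable_measureReal_max_martingale {p r : ℝ} (hp1 : 1 < p) (hpr : p < r)
    (hB : IsRSmooth r B) {α : ℝ} (hα0 : 0 < α) (hα1 : α ≤ 1) {ℱ : Filtration ℕ m0}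
    {D : ℕ → Ω → B} (hDm : ∀ i, StronglyMeasurable[ℱ (i + 1)] (D i))
    (hDp : Integrable (fun ω => ‖D 0 ω‖ ^ p) P) (hD0 : ∀ i, P[D i | ℱ i] =ᵐ[P] 0)
    (hDid : ∀ i, IdentDistrib (fun ω => ‖D i ω‖) (fun ω => ‖D 0 ω‖) P P) {δ : ℝ} (hδ : 0 < δ) :
    Summable fun n : ℕ => ((n + 1 : ℕ) : ℝ) ^ (α * p - 2) * P.real
      {ω | ∃ k ≤ n + 1, δ * ((n + 1 : ℕ) : ℝ) ^ α ≤ ‖∑ i ∈ Finset.range k, D i ω‖} := by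
  obtain ⟨A, hA, h⟩ := exists_measureReal_max_sum_le (m0 := m0) (P := P) hB
  have hDm' : ∀ i, StronglyMeasurable (D i) := fun i => (hDm i).mono (ℱ.le _)
  have hY := (hDm' 0).norm.measurable
  have hY0 : ∀ ω, 0 ≤ ‖D 0 ω‖ := fun ω => norm_nonneg _
  have hYi := integrable_of_rpow hp1.le hY.aestronglyMeasurable hY0 hDp
  have hDi : ∀ i, Integrable (D i) P := fun i =>
    (integrable_norm_iff (hDm' i).aestronglyMeasurable).1 ((hDid i).integrable_iff.2 hYi)
  have s1 := (summable_integral_small hα0 hα1 hp1 hpr hB.2.1 hY hY0 hDp).mul_left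
    (A * (δ ^ r)⁻¹)
  have s2 := (summable_integral_large hα0 hα1 hp1 (hpr.le.trans hB.2.1) one_pos hY hY0
    hDp).mul_left (4 * δ⁻¹)
  refine Summable.of_nonneg_of_le (fun n => by positivity) (fun n => ?_) (s1.add s2)
  set x : ℝ := ((n + 1 : ℕ) : ℝ) with hx
  have hx0 : 0 < x := by positivity
  have h1 := h hDm hDi hD0 hDid (n + 1) (l := δ * x ^ α) (c := x ^ α) (by positivity)
    (by positivity)
  rw [← hx] at h1
  refine (mul_le_mul_of_nonneg_left h1 (by positivity)).trans (le_of_eq ?_)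
  have e1 : x ^ (α * p - 1 - α * r) = x ^ (α * p - 2) * x * ((x ^ α) ^ r)⁻¹ := by
    rw [← Real.rpow_mul hx0.le, ← Real.rpow_neg hx0.le, ← Real.rpow_add_one hx0.ne',
      ← Real.rpow_add hx0]
    congr 1; ring
  have e2 : x ^ (α * p - 1 - α) = x ^ (α * p - 2) * x * (x ^ α)⁻¹ := by
    rw [← Real.rpow_neg hx0.le, ← Real.rpow_add_one hx0.ne', ← Real.rpow_add hx0]
    congr 1; ring
  rw [e1, e2, Real.mul_rpow hδ.le (by positivity), mul_inv, mul_inv]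
  simp only [one_mul]
  ring

end BaumKatz

/-! ### Independence of the past and the freezing lemma -/

section Independence

variable {Ω B : Type*} {m0 : MeasurableSpace Ω} {P : Measure Ω}
  [NormedAddCommGroup B] [NormedSpace ℝ B] [MeasurableSpace B]

/-- The `σ`-algebras generated by the single coefficients (left summand) and innovations (right
summand). -/
@[reducible] noncomputable def noiseSigma (ρ : ℤ → Ω → (B →L[ℝ] B)) (ε : ℤ → Ω → B) :
    ℤ ⊕ ℤ → MeasurableSpace Ω :=
  Sum.elim (fun j => MeasurableSpace.comap (ρ j) inferInstance)
    (fun j => MeasurableSpace.comap (ε j) inferInstance)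

/-- The `σ`-algebra of the past up to time `n`, generated by `ρ j` and `ε j` for `j ≤ n`. -/
@[reducible] noncomputable def pastSigma (ρ : ℤ → Ω → (B →L[ℝ] B)) (ε : ℤ → Ω → B) (n : ℤ) :
    MeasurableSpace Ω :=
  ⨆ i ∈ {i : ℤ ⊕ ℤ | Sum.elim id id i ≤ n}, noiseSigma ρ ε i

variable {ρ : ℤ → Ω → (B →L[ℝ] B)} {ε : ℤ → Ω → B}

lemma noiseSigma_le (hρ : ∀ n, Measurable (ρ n)) (hε : ∀ n, Measurable (ε n)) (i : ℤ ⊕ ℤ) :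
    noiseSigma ρ ε i ≤ m0 := by
  rcases i with j | j
  exacts [(hρ j).comap_le, (hε j).comap_le]

lemma pastSigma_le (hρ : ∀ n, Measurable (ρ n)) (hε : ∀ n, Measurable (ε n)) (n : ℤ) :
    pastSigma ρ ε n ≤ m0 :=
  iSup₂_le fun i _ => noiseSigma_le hρ hε i

lemma pastSigma_mono : Monotone (pastSigma ρ ε) := fun _ _ h =>
  biSup_mono fun _ hi => le_trans hi h

lemma measurable_coeff_pastSigma {j n : ℤ} (h : j ≤ n) : Measurable[pastSigma ρ ε n] (ρ j) :=
  measurable_iff_comap_le.2 <|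
    le_iSup₂_of_le (f := fun i (_ : i ∈ {i : ℤ ⊕ ℤ | Sum.elim id id i ≤ n}) => noiseSigma ρ ε i)
      (Sum.inl j) h le_rfl

lemma measurable_innov_pastSigma {j n : ℤ} (h : j ≤ n) : Measurable[pastSigma ρ ε n] (ε j) :=
  measurable_iff_comap_le.2 <|
    le_iSup₂_of_le (f := fun i (_ : i ∈ {i : ℤ ⊕ ℤ | Sum.elim id id i ≤ n}) => noiseSigma ρ ε i)
      (Sum.inr j) h le_rfl

lemma iIndep_noiseSigma [IsProbabilityMeasure P] (hρ : IsIID P ρ) (hε : IsIID P ε)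
    (h : CoeffIndepNoise P ρ ε) : iIndep (noiseSigma ρ ε) P := by
  rw [iIndep_iff]
  intro s f hf
  have hsplit : (⋂ i ∈ s, f i) =
      (⋂ j ∈ s.toLeft, f (Sum.inl j)) ∩ ⋂ j ∈ s.toRight, f (Sum.inr j) := by
    ext ω
    simp only [Set.mem_iInter, Set.mem_inter_iff, Finset.mem_toLeft, Finset.mem_toRight]
    constructor
    · exact fun h => ⟨fun j => h _, fun j => h _⟩
    · rintro ⟨h1, h2⟩ (j | j) hj
      exacts [h1 j hj, h2 j hj]
  have h1 : MeasurableSet[MeasurableSpace.comap (fun ω (n : ℤ) => ρ n ω) inferInstance]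
      (⋂ j ∈ s.toLeft, f (Sum.inl j)) := by
    refine Finset.measurableSet_biInter _ fun j hj => ?_
    obtain ⟨t, ht, hft⟩ := hf (Sum.inl j) (Finset.mem_toLeft.1 hj)
    exact ⟨(fun x : ℤ → (B →L[ℝ] B) => x j) ⁻¹' t, measurable_pi_apply j ht, hft⟩
  have h2 : MeasurableSet[MeasurableSpace.comap (fun ω (n : ℤ) => ε n ω) inferInstance]
      (⋂ j ∈ s.toRight, f (Sum.inr j)) := by
    refine Finset.measurableSet_biInter _ fun j hj => ?_
    obtain ⟨t, ht, hft⟩ := hf (Sum.inr j) (Finset.mem_toRight.1 hj)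
    exact ⟨(fun x : ℤ → B => x j) ⁻¹' t, measurable_pi_apply j ht, hft⟩
  rw [hsplit, (Indep_iff _ _ _).1 h _ _ h1 h2, Finset.prod_sum_eq_prod_toLeft_mul_prod_toRight,
    hρ.indep.meas_biInter fun j hj => hf _ (Finset.mem_toLeft.1 hj),
    hε.indep.meas_biInter fun j hj => hf _ (Finset.mem_toRight.1 hj)]

lemma indep_noiseSigma_pastSigma [IsProbabilityMeasure P] (hρ : IsIID P ρ) (hε : IsIID P ε)
    (h : CoeffIndepNoise P ρ ε) {n : ℤ} {i : ℤ ⊕ ℤ} (hi : n < Sum.elim id id i) :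
    Indep (noiseSigma ρ ε i) (pastSigma ρ ε n) P := by
  have h1 := indep_iSup_of_disjoint (noiseSigma_le hρ.measurable hε.measurable)
    (iIndep_noiseSigma hρ hε h) (S := {i}) (T := {i | Sum.elim id id i ≤ n})
    (Set.disjoint_singleton_left.2 (not_le.2 hi))
  rwa [iSup_singleton] at h1

lemma indepFun_coeff_of_measurable [IsProbabilityMeasure P] (hρ : IsIID P ρ) (hε : IsIID P ε)
    (h : CoeffIndepNoise P ρ ε) {E : Type*} [MeasurableSpace E] {n : ℤ} {W : Ω → E}
    (hW : Measurable[pastSigma ρ ε (n - 1)] W) : IndepFun (ρ n) W P :=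
  indep_of_indep_of_le_right
    (indep_noiseSigma_pastSigma hρ hε h (i := Sum.inl n) (show n - 1 < n by omega))
    hW.comap_le

end Independence

section Freezing

variable {Ω B : Type*} {m m0 : MeasurableSpace Ω} {P : Measure Ω}

lemma eLpNorm_mul_of_indepFun {f g : Ω → ℝ} (hf : AEMeasurable f P) (hg : AEMeasurable g P)
    (h : IndepFun f g P) {p : ℝ} (hp : 0 < p) :
    eLpNorm (fun ω => f ω * g ω) (ENNReal.ofReal p) P =
      eLpNorm f (ENNReal.ofReal p) P * eLpNorm g (ENNReal.ofReal p) P := by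
  have h0 : ENNReal.ofReal p ≠ 0 := by simpa using hp
  simp only [eLpNorm_eq_lintegral_rpow_enorm_toReal h0 ENNReal.ofReal_ne_top,
    ENNReal.toReal_ofReal hp.le, enorm_mul]
  rw [← ENNReal.mul_rpow_of_nonneg _ _ (by positivity)]
  congr 1
  have hm : Measurable fun x : ℝ => ‖x‖ₑ ^ p := measurable_enorm.pow_const p
  refine Eq.trans (lintegral_congr fun ω => ENNReal.mul_rpow_of_nonneg _ _ hp.le)
    (lintegral_mul_eq_lintegral_mul_lintegral_of_indepFun'' (hm.comp_aemeasurable hf)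
      (hm.comp_aemeasurable hg) (h.comp hm hm))

variable [IsProbabilityMeasure P] [NormedAddCommGroup B] [NormedSpace ℝ B] [MeasurableSpace B]
  [BorelSpace B] [TopologicalSpace.SeparableSpace B]

/-- The evaluation map is jointly measurable, although `B →L[ℝ] B` need not be separable: it is
continuous in the vector and measurable in the operator. -/
lemma measurable_apply_prod : Measurable fun q : (B →L[ℝ] B) × B => q.1 q.2 := by
  have : SecondCountableTopology B := UniformSpace.secondCountable_of_separable B
  exact (measurable_uncurry_of_continuous_of_measurable (u := fun (b : B) (T : B →L[ℝ] B) => T b)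
    (fun T => T.continuous) fun b => ContinuousLinearMap.measurable_apply b).comp measurable_swap

variable [CompleteSpace B]

/-- Freezing lemma: if `R` is independent of `m` and `W` is `m`-measurable, the conditional
expectation of `R W` given `m` is obtained by averaging over `R` alone. -/
lemma condExp_apply_eq (hm : m ≤ m0) {R : Ω → (B →L[ℝ] B)}
    (hR : Measurable R) (hRi : Integrable (fun ω => ‖R ω‖) P)
    (hind : Indep (MeasurableSpace.comap R inferInstance) m P) {W : Ω → B}
    (hW : StronglyMeasurable[m] W) (hWi : Integrable W P) {A : B →L[ℝ] B}
    (hA : ∀ x, ∫ ω, R ω x ∂P = A x) :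
    Integrable (fun ω => R ω (W ω)) P ∧
      P[fun ω => R ω (W ω) | m] =ᵐ[P] fun ω => A (W ω) := by
  have : SecondCountableTopology B := UniformSpace.secondCountable_of_separable B
  have hind' : ∀ {V : Ω → B}, StronglyMeasurable[m] V → IndepFun R V P := fun hV =>
    indep_of_indep_of_le_right hind hV.measurable.comap_le
  have hint : ∀ {V : Ω → B}, StronglyMeasurable[m] V → Integrable V P →
      Integrable (fun ω => R ω (V ω)) P := fun {V} hV hVi => by
    have h1 : Integrable (fun ω => ‖R ω‖ * ‖V ω‖) P :=
      ((hind' hV).comp measurable_norm measurable_norm).integrable_mul hRi hVi.norm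
    refine h1.mono' ?_ (.of_forall fun ω => (R ω).le_opNorm _)
    exact (measurable_apply_prod.comp (hR.prodMk
      (hV.mono hm).measurable)).aestronglyMeasurable
  have hint_eq : ∀ {V : Ω → B}, StronglyMeasurable[m] V → Integrable V P →
      ∫ ω, R ω (V ω) ∂P = ∫ ω, A (V ω) ∂P := fun {V} hV hVi => by
    have hVm : Measurable V := (hV.mono hm).measurable
    have hmap := (indepFun_iff_map_prod_eq_prod_map_map hVm.aemeasurable hR.aemeasurable).1
      (hind' hV).symm
    have hf : Measurable fun q : B × (B →L[ℝ] B) => q.2 q.1 :=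
      measurable_apply_prod.comp measurable_swap
    have := Measure.isProbabilityMeasure_map (μ := P) hR.aemeasurable
    have := Measure.isProbabilityMeasure_map (μ := P) hVm.aemeasurable
    have hi : Integrable (fun q : B × (B →L[ℝ] B) => q.2 q.1) ((P.map V).prod (P.map R)) := by
      rw [← hmap]
      exact (integrable_map_measure hf.aestronglyMeasurable
        (hVm.prodMk hR).aemeasurable).2 (hint hV hVi)
    calc ∫ ω, R ω (V ω) ∂P
        = ∫ q, q.2 q.1 ∂(P.map fun ω => (V ω, R ω)) :=
          (integral_map (f := fun q : B × (B →L[ℝ] B) => q.2 q.1) (hVm.prodMk hR).aemeasurable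
            hf.aestronglyMeasurable).symm
      _ = ∫ v, ∫ T, T v ∂(P.map R) ∂(P.map V) := by rw [hmap, integral_prod _ hi]
      _ = ∫ v, A v ∂(P.map V) := by
          refine integral_congr_ae (.of_forall fun v => ?_)
          simp only
          rw [← hA v]
          exact integral_map hR.aemeasurable
            (ContinuousLinearMap.measurable_apply v).aestronglyMeasurable
      _ = _ := integral_map hVm.aemeasurable A.continuous.aestronglyMeasurable
  refine ⟨hint hW hWi, ?_⟩
  refine (ae_eq_condExp_of_forall_setIntegral_eq hm (hint hW hWi)
    (fun s _ _ => (A.integrable_comp hWi).integrableOn) (fun s hs _ => ?_)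
    (A.continuous.comp_stronglyMeasurable hW).aestronglyMeasurable).symm
  have h1 := hint_eq (hW.indicator hs) (hWi.indicator (hm s hs))
  rw [← integral_indicator (hm s hs), ← integral_indicator (hm s hs)]
  refine Eq.trans ?_ (h1.symm.trans ?_)
  all_goals
    refine integral_congr_ae (.of_forall fun ω => ?_)
    by_cases hω : ω ∈ s <;> simp [hω]

end Freezing

/-! ### Causality of stationary solutions -/

section Causality

variable {Ω B : Type*} [NormedAddCommGroup B] [NormedSpace ℝ B]

/-- The value at time `n` of the recursion started from `0` at time `n - k`. -/
noncomputable def truncatedSolution (ρ : ℤ → Ω → (B →L[ℝ] B)) (ε : ℤ → Ω → B) :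
    ℕ → ℤ → Ω → B
  | 0, _ => fun _ => 0
  | k + 1, n => fun ω => ρ n ω (truncatedSolution ρ ε k (n - 1) ω) + ε n ω

/-- The product `‖ρ n‖ ‖ρ (n - 1)‖ ⋯ ‖ρ (n - k + 1)‖` of `k` operator norms. -/
noncomputable def coeffNormProd (ρ : ℤ → Ω → (B →L[ℝ] B)) : ℕ → ℤ → Ω → ℝ
  | 0, _ => fun _ => 1
  | k + 1, n => fun ω => ‖ρ n ω‖ * coeffNormProd ρ k (n - 1) ω

variable {ρ : ℤ → Ω → (B →L[ℝ] B)} {ε : ℤ → Ω → B}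

lemma coeffNormProd_nonneg (k : ℕ) (n : ℤ) (ω : Ω) : 0 ≤ coeffNormProd ρ k n ω := by
  induction k generalizing n with
  | zero => exact zero_le_one
  | succ k ih => exact mul_nonneg (norm_nonneg _) (ih _)

lemma norm_sub_truncatedSolution_le {Z : ℤ → Ω → B} {ω : Ω}
    (h : ∀ n, Z n ω = ρ n ω (Z (n - 1) ω) + ε n ω) (k : ℕ) (n : ℤ) :
    ‖Z n ω - truncatedSolution ρ ε k n ω‖ ≤ coeffNormProd ρ k n ω * ‖Z (n - k) ω‖ := by
  induction k generalizing n with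
  | zero => simp [truncatedSolution, coeffNormProd]
  | succ k ih =>
    rw [h n, truncatedSolution, coeffNormProd, add_sub_add_right_eq_sub, ← map_sub, mul_assoc]
    refine ((ρ n ω).le_opNorm _).trans (mul_le_mul_of_nonneg_left ?_ (norm_nonneg _))
    have e : n - ((k + 1 : ℕ) : ℤ) = n - 1 - k := by push_cast; ring
    rw [e]
    exact ih (n - 1)

variable [MeasurableSpace B]

lemma measurable_coeffNormProd (k : ℕ) (n : ℤ) :
    Measurable[pastSigma ρ ε n] (coeffNormProd ρ k n) := by
  induction k generalizing n with
  | zero => exact measurable_const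
  | succ k ih =>
    exact (measurable_norm.comp (measurable_coeff_pastSigma le_rfl)).mul
      ((ih (n - 1)).mono (pastSigma_mono (by omega)) le_rfl)

lemma eLpNorm_coeff_mul {m0 : MeasurableSpace Ω} {P : Measure Ω} [IsProbabilityMeasure P]
    (hρ : IsIID P ρ) (hε : IsIID P ε) (h : CoeffIndepNoise P ρ ε) {p : ℝ}
    (hp : 0 < p) {n : ℤ} {f : Ω → ℝ} (hf : Measurable[pastSigma ρ ε (n - 1)] f) :
    eLpNorm (fun ω => ‖ρ n ω‖ * f ω) (ENNReal.ofReal p) P =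
      eLpNorm (fun ω => ‖ρ 0 ω‖) (ENNReal.ofReal p) P * eLpNorm f (ENNReal.ofReal p) P := by
  refine (eLpNorm_mul_of_indepFun (f := fun ω => ‖ρ n ω‖)
    (measurable_norm.comp (hρ.measurable n)).aemeasurable
    (hf.mono (pastSigma_le hρ.measurable hε.measurable _) le_rfl).aemeasurable
    ((indepFun_coeff_of_measurable hρ hε h hf).comp measurable_norm measurable_id) hp).trans ?_
  congr 1
  exact ((hρ.identDistrib n).comp measurable_norm).eLpNorm_eq _

lemma eLpNorm_coeffNormProd {m0 : MeasurableSpace Ω} {P : Measure Ω} [IsProbabilityMeasure P]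
    (hρ : IsIID P ρ) (hε : IsIID P ε) (h : CoeffIndepNoise P ρ ε)
    {p : ℝ} (hp : 0 < p) (k : ℕ) (n : ℤ) :
    eLpNorm (coeffNormProd ρ k n) (ENNReal.ofReal p) P =
      eLpNorm (fun ω => ‖ρ 0 ω‖) (ENNReal.ofReal p) P ^ k := by
  induction k generalizing n with
  | zero =>
    rw [pow_zero]
    refine (eLpNorm_const (1 : ℝ) (by simpa using hp) (NeZero.ne P)).trans ?_
    simp
  | succ k ih =>
    rw [coeffNormProd, eLpNorm_coeff_mul hρ hε h hp (measurable_coeffNormProd k (n - 1)), ih,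
      pow_succ']

/-- The truncated solutions converge in probability to any solution of the recursion whose
one-dimensional laws all agree: the error is at most the norm product, which decays geometrically
in mean, times a tight factor. -/
lemma tendstoInMeasure_truncatedSolution [BorelSpace B] {m0 : MeasurableSpace Ω}
    {P : Measure Ω} [IsProbabilityMeasure P] (hρ : IsIID P ρ) (hε : IsIID P ε)
    (h : CoeffIndepNoise P ρ ε) {p : ℝ} (hp : 1 ≤ p)
    (ha : eLpNorm (fun ω => ‖ρ 0 ω‖) (ENNReal.ofReal p) P < 1) {Z : ℤ → Ω → B}
    (hZ : ∀ n, IdentDistrib (Z n) (Z 0) P P)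
    (hrec : ∀ n, ∀ᵐ ω ∂P, Z n ω = ρ n ω (Z (n - 1) ω) + ε n ω) (n : ℤ) :
    TendstoInMeasure P (fun k => truncatedSolution ρ ε k n) atTop (Z n) := by
  rw [tendstoInMeasure_iff_measureReal_norm]
  intro η hη
  set a := (eLpNorm (fun ω => ‖ρ 0 ω‖) (ENNReal.ofReal p) P).toReal with ha'
  have ha1 : a < 1 := by
    rw [ha', ← ENNReal.toReal_one]
    exact ENNReal.toReal_strict_mono ENNReal.one_ne_top ha
  have hprod : ∀ k, Integrable (coeffNormProd ρ k n) P ∧ ∫ ω, coeffNormProd ρ k n ω ∂P ≤ a ^ k := by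
    intro k
    have hm : AEStronglyMeasurable (coeffNormProd ρ k n) P :=
      ((measurable_coeffNormProd (ε := ε) k n).mono
        (pastSigma_le hρ.measurable hε.measurable n) le_rfl).aestronglyMeasurable
    have h1 : eLpNorm (coeffNormProd ρ k n) 1 P ≤
        eLpNorm (fun ω => ‖ρ 0 ω‖) (ENNReal.ofReal p) P ^ k :=
      (eLpNorm_le_eLpNorm_of_exponent_le (by simpa using hp) hm).trans_eq
        (eLpNorm_coeffNormProd hρ hε h (by linarith) k n)
    have h2 : eLpNorm (fun ω => ‖ρ 0 ω‖) (ENNReal.ofReal p) P ^ k ≠ ⊤ :=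
      ENNReal.pow_ne_top (ha.trans ENNReal.one_lt_top).ne
    have h3 : Integrable (coeffNormProd ρ k n) P :=
      memLp_one_iff_integrable.1 ⟨hm, h1.trans_lt h2.lt_top⟩
    refine ⟨h3, ?_⟩
    calc ∫ ω, coeffNormProd ρ k n ω ∂P = ∫ ω, ‖coeffNormProd ρ k n ω‖ ∂P :=
          integral_congr_ae (.of_forall fun ω =>
            (Real.norm_of_nonneg (coeffNormProd_nonneg k n ω)).symm)
      _ = (eLpNorm (coeffNormProd ρ k n) 1 P).toReal := by
          rw [eLpNorm_one_eq_lintegral_enorm, integral_norm_eq_lintegral_enorm hm]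
      _ ≤ _ := by
          rw [ha', ← ENNReal.toReal_pow]
          exact ENNReal.toReal_mono h2 h1
  have htight : Tendsto (fun k : ℕ => P.real {ω | (k : ℝ) ≤ ‖Z 0 ω‖}) atTop (𝓝 0) := by
    have hmeas : AEMeasurable (fun ω => ‖Z 0 ω‖) P :=
      measurable_norm.comp_aemeasurable (hZ 0).aemeasurable_fst
    have h1 := tendsto_measure_iInter_atTop (μ := P) (s := fun k : ℕ => {ω | (k : ℝ) ≤ ‖Z 0 ω‖})
      (fun k => nullMeasurableSet_le aemeasurable_const hmeas)
      (fun i j hij ω hω => show (i : ℝ) ≤ ‖Z 0 ω‖ from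
        le_trans (Nat.cast_le.2 hij) (show (j : ℝ) ≤ ‖Z 0 ω‖ from hω)) ⟨0, measure_ne_top _ _⟩
    have h2 : ⋂ k : ℕ, {ω | (k : ℝ) ≤ ‖Z 0 ω‖} = ∅ := by
      ext ω
      simp only [Set.mem_iInter, Set.mem_ofPred_eq, Set.mem_empty_iff_false, iff_false, not_forall,
        not_le]
      exact exists_nat_gt _
    rw [h2, measure_empty] at h1
    exact (ENNReal.tendsto_toReal ENNReal.zero_ne_top).comp h1
  have hgeom : Tendsto (fun k : ℕ => η⁻¹ * (k * a ^ k)) atTop (𝓝 0) := by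
    have h1 := (tendsto_self_mul_const_pow_of_lt_one ENNReal.toReal_nonneg ha1).const_mul η⁻¹
    rwa [mul_zero] at h1
  have hsum := htight.add hgeom
  rw [add_zero] at hsum
  refine squeeze_zero' (.of_forall fun k => measureReal_nonneg) ?_ hsum
  filter_upwards [eventually_gt_atTop 0] with k hk
  have hk0 : (0 : ℝ) < k := Nat.cast_pos.2 hk
  -- either `‖Z (n - k)‖` is at least `k` or the norm product is at least `η / k`
  have hsub : P.real {ω | η ≤ ‖truncatedSolution ρ ε k n ω - Z n ω‖} ≤
      P.real ({ω | (k : ℝ) ≤ ‖Z (n - k) ω‖} ∪ {ω | η / k ≤ coeffNormProd ρ k n ω}) := by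
    refine ENNReal.toReal_mono (measure_ne_top _ _) (measure_mono_ae ?_)
    filter_upwards [ae_all_iff.2 hrec] with ω hω hη'
    by_contra hcon
    obtain ⟨h1, h2⟩ := not_or.1 (show ¬ ((k : ℝ) ≤ ‖Z (n - k) ω‖ ∨
      η / k ≤ coeffNormProd ρ k n ω) from hcon)
    have h3 : η ≤ ‖Z n ω - truncatedSolution ρ ε k n ω‖ := by
      rw [norm_sub_rev]; exact hη'
    have h4 := h3.trans (norm_sub_truncatedSolution_le hω k n)
    have h5 : coeffNormProd ρ k n ω * ‖Z (n - k) ω‖ < η / k * k :=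
      mul_lt_mul'' (not_le.1 h2) (not_le.1 h1) (coeffNormProd_nonneg k n ω) (norm_nonneg _)
    rw [div_mul_cancel₀ _ hk0.ne'] at h5
    exact absurd h4 (not_le.2 h5)
  refine (hsub.trans (measureReal_union_le _ _)).trans (add_le_add (le_of_eq ?_) ?_)
  · exact congrArg ENNReal.toReal (((hZ (n - k)).comp measurable_norm).measure_mem_eq
      (measurableSet_Ici (a := (k : ℝ))))
  · have h1 := mul_meas_ge_le_integral_of_nonneg (μ := P)
      (.of_forall (coeffNormProd_nonneg k n)) (hprod k).1 (η / k)
    have h2 := h1.trans (hprod k).2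
    calc _ = k / η * (η / k * P.real {ω | η / k ≤ coeffNormProd ρ k n ω}) := by field_simp
      _ ≤ k / η * a ^ k := by gcongr
      _ = _ := by ring

variable [BorelSpace B] [TopologicalSpace.SeparableSpace B]

lemma measurable_truncatedSolution (k : ℕ) (n : ℤ) :
    Measurable[pastSigma ρ ε n] (truncatedSolution ρ ε k n) := by
  have : SecondCountableTopology B := UniformSpace.secondCountable_of_separable B
  induction k generalizing n with
  | zero => exact measurable_const
  | succ k ih =>
    exact (measurable_apply_prod.comp ((measurable_coeff_pastSigma le_rfl).prodMk
      ((ih (n - 1)).mono (pastSigma_mono (by omega)) le_rfl))).add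
      (measurable_innov_pastSigma le_rfl)

lemma stronglyMeasurable_truncatedSolution (k : ℕ) (n : ℤ) :
    StronglyMeasurable[pastSigma ρ ε n] (truncatedSolution ρ ε k n) := by
  have : SecondCountableTopology B := UniformSpace.secondCountable_of_separable B
  let _ := pastSigma ρ ε n
  exact (measurable_truncatedSolution k n).stronglyMeasurable

lemma stronglyMeasurable_limUnder_truncatedSolution [CompleteSpace B] (φ : ℕ → ℕ) (n : ℤ) :
    StronglyMeasurable[pastSigma ρ ε n]
      fun ω => limUnder atTop fun i => truncatedSolution ρ ε (φ i) n ω := by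
  let _ := pastSigma ρ ε n
  exact StronglyMeasurable.limUnder fun i => stronglyMeasurable_truncatedSolution (φ i) n

variable {m0 : MeasurableSpace Ω} {P : Measure Ω} [IsProbabilityMeasure P]

lemma eLpNorm_truncatedSolution_le (hρ : IsIID P ρ) (hε : IsIID P ε)
    (h : CoeffIndepNoise P ρ ε) {p : ℝ} (hp : 1 ≤ p) (k : ℕ) (n : ℤ) :
    eLpNorm (truncatedSolution ρ ε k n) (ENNReal.ofReal p) P ≤
      eLpNorm (ε 0) (ENNReal.ofReal p) P *
        ∑ j ∈ Finset.range k, eLpNorm (fun ω => ‖ρ 0 ω‖) (ENNReal.ofReal p) P ^ j := by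
  have : SecondCountableTopology B := UniformSpace.secondCountable_of_separable B
  have hle := pastSigma_le hρ.measurable hε.measurable
  induction k generalizing n with
  | zero =>
    rw [show truncatedSolution ρ ε 0 n = 0 from rfl]
    simp
  | succ k ih =>
    have hm := measurable_truncatedSolution (ρ := ρ) (ε := ε) k (n - 1)
    have h1 : eLpNorm (fun ω => ρ n ω (truncatedSolution ρ ε k (n - 1) ω)) (ENNReal.ofReal p) P ≤
        eLpNorm (fun ω => ‖ρ n ω‖ * ‖truncatedSolution ρ ε k (n - 1) ω‖) (ENNReal.ofReal p) P :=
      eLpNorm_mono_real fun ω => (ρ n ω).le_opNorm _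
    rw [eLpNorm_coeff_mul hρ hε h (f := fun ω => ‖truncatedSolution ρ ε k (n - 1) ω‖)
      (by linarith) (measurable_norm.comp hm),
      eLpNorm_norm (truncatedSolution ρ ε k (n - 1))] at h1
    have h2 : eLpNorm (ε n) (ENNReal.ofReal p) P = eLpNorm (ε 0) (ENNReal.ofReal p) P :=
      (hε.identDistrib n).eLpNorm_eq _
    have h3 : Measurable fun ω => ρ n ω (truncatedSolution ρ ε k (n - 1) ω) :=
      measurable_apply_prod.comp ((hρ.measurable n).prodMk (hm.mono (hle _) le_rfl))
    have h4 := eLpNorm_add_le (p := ENNReal.ofReal p) (h3.aestronglyMeasurable (μ := P))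
      (hε.measurable n).aestronglyMeasurable (by simpa using hp)
    refine h4.trans ?_
    rw [h2, geom_sum_succ, mul_add, mul_one, mul_left_comm]
    refine add_le_add (h1.trans ?_) le_rfl
    gcongr
    exact ih (n - 1)

variable [CompleteSpace B]

/-- A solution of the recursion with constant one-dimensional laws is causal and lies in `L^p`. -/
lemma exists_causal_version (hρ : IsIID P ρ) (hε : IsIID P ε) (h : CoeffIndepNoise P ρ ε) {p : ℝ}
    (hp : 1 ≤ p) (ha : eLpNorm (fun ω => ‖ρ 0 ω‖) (ENNReal.ofReal p) P < 1)
    (hεp : MemLp (ε 0) (ENNReal.ofReal p) P) {Z : ℤ → Ω → B}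
    (hZ : ∀ n, IdentDistrib (Z n) (Z 0) P P)
    (hrec : ∀ n, ∀ᵐ ω ∂P, Z n ω = ρ n ω (Z (n - 1) ω) + ε n ω) (n : ℤ) :
    ∃ W : Ω → B, StronglyMeasurable[pastSigma ρ ε n] W ∧ W =ᵐ[P] Z n ∧
      MemLp W (ENNReal.ofReal p) P := by
  have : SecondCountableTopology B := UniformSpace.secondCountable_of_separable B
  have hle := pastSigma_le hρ.measurable hε.measurable n
  obtain ⟨φ, -, hφ⟩ :=
    (tendstoInMeasure_truncatedSolution hρ hε h hp ha hZ hrec n).exists_seq_tendsto_ae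
  have hW := stronglyMeasurable_limUnder_truncatedSolution (ρ := ρ) (ε := ε) φ n
  have hWZ : (fun ω => limUnder atTop fun i => truncatedSolution ρ ε (φ i) n ω) =ᵐ[P] Z n := by
    filter_upwards [hφ] with ω hω
    exact hω.limUnder_eq
  refine ⟨_, hW, hWZ, (hW.mono hle).aestronglyMeasurable, ?_⟩
  rw [eLpNorm_congr_ae hWZ]
  refine (Lp.eLpNorm_lim_le_liminf_eLpNorm
    (fun i => ((stronglyMeasurable_truncatedSolution _ n).mono hle).aestronglyMeasurable)
    (Z n) hφ).trans_lt ?_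
  have hbound : ∀ i, eLpNorm (truncatedSolution ρ ε (φ i) n) (ENNReal.ofReal p) P ≤
      eLpNorm (ε 0) (ENNReal.ofReal p) P *
        (1 - eLpNorm (fun ω => ‖ρ 0 ω‖) (ENNReal.ofReal p) P)⁻¹ := fun i => by
    refine (eLpNorm_truncatedSolution_le hρ hε h hp (φ i) n).trans ?_
    rw [← ENNReal.tsum_geometric]
    gcongr
    exact ENNReal.sum_le_tsum _
  refine (liminf_le_of_frequently_le' (.of_forall hbound)).trans_lt ?_
  exact ENNReal.mul_lt_top hεp.2 (ENNReal.inv_lt_top.2 (tsub_pos_of_lt ha))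

end Causality

/-! ### The mean operator and complete convergence -/

lemma eLpNorm_lt_one_of_integral_rpow_lt_one {Ω : Type*} {m0 : MeasurableSpace Ω} {P : Measure Ω}
    {p : ℝ} (hp : 0 < p) {f : Ω → ℝ} (hf0 : ∀ ω, 0 ≤ f ω)
    (hi : Integrable (fun ω => f ω ^ p) P) (h : ∫ ω, f ω ^ p ∂P < 1) :
    eLpNorm f (ENNReal.ofReal p) P < 1 := by
  rw [eLpNorm_eq_lintegral_rpow_enorm_toReal (by simpa using hp) ENNReal.ofReal_ne_top,
    ENNReal.toReal_ofReal hp.le]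
  refine ENNReal.rpow_lt_one ?_ (by positivity)
  have e : ∀ ω, ‖f ω‖ₑ ^ p = ENNReal.ofReal (f ω ^ p) := fun ω => by
    rw [Real.enorm_of_nonneg (hf0 ω), ENNReal.ofReal_rpow_of_nonneg (hf0 ω) hp.le]
  simp only [e]
  rw [← ofReal_integral_eq_lintegral_ofReal hi (.of_forall fun ω => Real.rpow_nonneg (hf0 ω) p)]
  exact ENNReal.ofReal_lt_one.2 h

section MeanOperator

variable {Ω B : Type*} {m0 : MeasurableSpace Ω} {P : Measure Ω}
  [NormedAddCommGroup B] [NormedSpace ℝ B] [MeasurableSpace B] [BorelSpace B]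
  [TopologicalSpace.SeparableSpace B]

/-- The mean of a random operator exists in the strong sense, with norm at most the mean norm. The
pointwise definition avoids Bochner integration in `B →L[ℝ] B`, which need not be separable. -/
lemma exists_mean_operator {R : Ω → (B →L[ℝ] B)} (hR : Measurable R)
    (hRi : Integrable (fun ω => ‖R ω‖) P) :
    ∃ A : B →L[ℝ] B, (∀ x, ∫ ω, R ω x ∂P = A x) ∧ ‖A‖ ≤ ∫ ω, ‖R ω‖ ∂P := by
  have : SecondCountableTopology B := UniformSpace.secondCountable_of_separable B
  have hbd : ∀ x : B, Integrable (fun ω => ‖R ω‖ * ‖x‖) P := fun x => hRi.mul_const ‖x‖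
  have hint : ∀ x, Integrable (fun ω => R ω x) P := fun x =>
    (hbd x).mono' ((ContinuousLinearMap.measurable_apply x).comp hR).aestronglyMeasurable
      (.of_forall fun ω => (R ω).le_opNorm x)
  have h0 : 0 ≤ ∫ ω, ‖R ω‖ ∂P := integral_nonneg fun ω => norm_nonneg (R ω)
  let L : B →ₗ[ℝ] B :=
    { toFun := fun x => ∫ ω, R ω x ∂P
      map_add' := fun x y => by simp only [map_add]; exact integral_add (hint x) (hint y)
      map_smul' := fun c x => by simp only [map_smul, integral_smul, RingHom.id_apply] }
  have hL : ∀ x, ‖L x‖ ≤ (∫ ω, ‖R ω‖ ∂P) * ‖x‖ := fun x => by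
    rw [← integral_mul_const]
    exact norm_integral_le_of_norm_le (hbd x) (.of_forall fun ω => (R ω).le_opNorm x)
  exact ⟨L.mkContinuous _ hL, fun x => rfl, L.mkContinuous_norm_le h0 hL⟩

end MeanOperator

/-- Summation by parts: up to the boundary terms `z 0` and `z k`, the partial sums of `z` are
dominated by those of `z (i + 1) - A (z i)` as soon as `‖A‖ < 1`. -/
lemma one_sub_norm_mul_norm_sum_le {B : Type*} [NormedAddCommGroup B] [NormedSpace ℝ B]
    {A : B →L[ℝ] B} (hA : ‖A‖ ≤ 1) (z : ℕ → B) (k : ℕ) :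
    (1 - ‖A‖) * ‖∑ i ∈ Finset.range k, z (i + 1)‖ ≤
      ‖∑ i ∈ Finset.range k, (z (i + 1) - A (z i))‖ + ‖z 0‖ + ‖z k‖ := by
  set s := ∑ i ∈ Finset.range k, z (i + 1) with hs
  have h1 : s - A s = ∑ i ∈ Finset.range k, (z (i + 1) - A (z i)) + A (z 0 - z k) := by
    have h2 : ∑ i ∈ Finset.range k, z i = s + z 0 - z k := by
      rw [hs, ← Finset.sum_range_succ' z k, Finset.sum_range_succ]; abel
    rw [Finset.sum_sub_distrib, ← map_sum, h2, ← hs]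
    simp only [map_sub, map_add]; abel
  have h3 : ‖s‖ ≤ ‖s - A s‖ + ‖A‖ * ‖s‖ := by
    have := norm_add_le (s - A s) (A s)
    rw [sub_add_cancel] at this
    linarith [A.le_opNorm s]
  have h4 : ‖A (z 0 - z k)‖ ≤ ‖z 0‖ + ‖z k‖ := by
    refine (A.le_opNorm _).trans ((mul_le_of_le_one_left (norm_nonneg _) hA).trans ?_)
    exact norm_sub_le _ _
  have h5 := norm_add_le (∑ i ∈ Finset.range k, (z (i + 1) - A (z i))) (A (z 0 - z k))
  rw [← h1] at h5
  linarith

end BRCA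

open BRCA

theorem theorem3p8 {Ω B : Type*} [MeasurableSpace Ω] (P : Measure Ω) [IsProbabilityMeasure P]
    [NormedAddCommGroup B] [NormedSpace ℝ B] [CompleteSpace B] [TopologicalSpace.SeparableSpace B]
    [MeasurableSpace B] [BorelSpace B]
    (p r : ℝ) (hp1 : 1 < p) (hp2 : p < 2) (hpr : p < r) (hB : BRCA.IsRSmooth r B)
    (μ : B) (ρ : ℤ → Ω → (B →L[ℝ] B)) (ε X : ℤ → Ω → B)
    (hC1 : BRCA.IIDCoeffLp P p ρ) (hC2 : BRCA.CoeffIndepNoise P ρ ε) (hC3 : BRCA.CoeffContractive P p ρ)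
    (hε : BRCA.IsIID P ε) (hε_mean : ∫ ω, ε 0 ω ∂P = 0)
    (hε_moment : Integrable (fun ω => ‖ε 0 ω‖ ^ p) P)
    (hX : BRCA.IsBRCA1 P μ ρ ε X) (hX_stat : BRCA.IsStrictlyStationary P X)
    (α : ℝ) (hα1 : 1 ≤ 1 / α) (hα2 : 1 / α ≤ p) (δ : ℝ) (hδ : 0 < δ) :
    Summable (fun n : ℕ => ((n + 1 : ℕ) : ℝ) ^ (α * p - 2) *
      P.real {ω | δ * ((n + 1 : ℕ) : ℝ) ^ α ≤ BRCA.maxNormPartialSum X μ (n + 1) ω}) := by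
  have : SecondCountableTopology B := UniformSpace.secondCountable_of_separable B
  have hα0 : 0 < α := by
    by_contra hcon
    have := one_div_nonpos.2 (not_lt.1 hcon)
    linarith
  have hα1' : α ≤ 1 := by rwa [le_div_iff₀ hα0, one_mul] at hα1
  have hp0 : 0 < p := by linarith
  have hp0' : ENNReal.ofReal p ≠ 0 := by simpa using hp0
  have hp1' : 1 ≤ ENNReal.ofReal p := by simpa using hp1.le
  have hρ := hC1.iid
  have hρm : Measurable fun ω => ‖ρ 0 ω‖ := measurable_norm.comp (hρ.measurable 0)
  have ha := eLpNorm_lt_one_of_integral_rpow_lt_one hp0 (fun ω => norm_nonneg (ρ 0 ω))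
    (hC1.integrable 0) hC3
  have hRi : Integrable (fun ω => ‖ρ 0 ω‖) P :=
    integrable_of_rpow hp1.le hρm.aestronglyMeasurable (fun ω => norm_nonneg _) (hC1.integrable 0)
  have hRlt : ∫ ω, ‖ρ 0 ω‖ ∂P < 1 := by
    have h1 : eLpNorm (fun ω => ‖ρ 0 ω‖) 1 P < 1 :=
      (eLpNorm_le_eLpNorm_of_exponent_le hp1' hρm.aestronglyMeasurable).trans_lt ha
    have h2 : ∫ ω, ‖ρ 0 ω‖ ∂P = (eLpNorm (fun ω => ‖ρ 0 ω‖) 1 P).toReal := by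
      rw [eLpNorm_one_eq_lintegral_enorm, ← integral_norm_eq_lintegral_enorm
        hρm.aestronglyMeasurable]
      simp only [norm_norm]
    rw [h2, ← ENNReal.toReal_one]
    exact ENNReal.toReal_strict_mono ENNReal.one_ne_top h1
  obtain ⟨A, hA, hAn⟩ := exists_mean_operator (hρ.measurable 0) hRi
  have hA1 : ‖A‖ < 1 := hAn.trans_lt hRlt
  have hεp : MemLp (ε 0) (ENNReal.ofReal p) P := by
    refine (integrable_norm_rpow_iff (hε.measurable 0).aestronglyMeasurable hp0'
      ENNReal.ofReal_ne_top).1 ?_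
    rwa [ENNReal.toReal_ofReal hp0.le]
  -- `W n` is a version of `X n - μ` that is measurable with respect to the past
  have hZm : ∀ n, Measurable fun ω => X n ω - μ := fun n => (hX.measurable n).sub_const μ
  have hZ : ∀ n, IdentDistrib (fun ω => X n ω - μ) (fun ω => X 0 ω - μ) P P := fun n => by
    have h := (hX_stat n).comp ((measurable_pi_apply (0 : ℤ)).sub_const μ)
    simpa only [Function.comp_def, zero_add] using h
  have hrec : ∀ n, ∀ᵐ ω ∂P, X n ω - μ = ρ n ω (X (n - 1) ω - μ) + ε n ω := hX.recursion
  choose W hWm hWZ hWp using exists_causal_version hρ hε hC2 hp1.le ha hεp hZ hrec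
  have hle := pastSigma_le hρ.measurable hε.measurable
  have hWi : ∀ n, Integrable (W n) P := fun n => (hWp n).integrable hp1'
  let ℱ : Filtration ℕ (inferInstance : MeasurableSpace Ω) :=
    { seq := fun i => pastSigma ρ ε i
      mono' := fun i j hij => pastSigma_mono (Int.ofNat_le.2 hij)
      le' := fun i => hle i }
  set D : ℕ → Ω → B := fun i ω => W ((i : ℤ) + 1) ω - A (W i ω) with hD
  have hDm : ∀ i, StronglyMeasurable[ℱ (i + 1)] (D i) := fun i => by
    have h1 : StronglyMeasurable[ℱ (i + 1)] (W ((i : ℤ) + 1)) := hWm ((i : ℤ) + 1)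
    have h2 : StronglyMeasurable[ℱ (i + 1)] (W i) := (hWm i).mono (ℱ.mono i.le_succ)
    exact h1.sub (A.continuous.comp_stronglyMeasurable h2)
  have hDp : Integrable (fun ω => ‖D 0 ω‖ ^ p) P := by
    have h1 : MemLp (D 0) (ENNReal.ofReal p) P := (hWp _).sub (A.comp_memLp' (hWp _))
    have h2 := h1.integrable_norm_rpow hp0' ENNReal.ofReal_ne_top
    rwa [ENNReal.toReal_ofReal hp0.le] at h2
  have hD0 : ∀ i, P[D i | ℱ i] =ᵐ[P] 0 := fun i => by
    have hind : Indep (MeasurableSpace.comap (ρ ((i : ℤ) + 1)) inferInstance) (ℱ i) P :=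
      indep_noiseSigma_pastSigma hρ hε hC2 (i := Sum.inl ((i : ℤ) + 1))
        (show (i : ℤ) < (i : ℤ) + 1 by omega)
    have hind' : Indep (MeasurableSpace.comap (ε ((i : ℤ) + 1)) inferInstance) (ℱ i) P :=
      indep_noiseSigma_pastSigma hρ hε hC2 (i := Sum.inr ((i : ℤ) + 1))
        (show (i : ℤ) < (i : ℤ) + 1 by omega)
    have hid := hρ.identDistrib ((i : ℤ) + 1)
    obtain ⟨h1i, h1⟩ := condExp_apply_eq (ℱ.le i) (hρ.measurable ((i : ℤ) + 1))
      ((hid.comp measurable_norm).integrable_iff.2 hRi) hind (hWm i) (hWi i)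
      (A := A) fun x => (hid.comp (ContinuousLinearMap.measurable_apply x)).integral_eq.trans (hA x)
    have hεi : Integrable (ε ((i : ℤ) + 1)) P :=
      (hε.identDistrib _).integrable_iff.2 (hεp.integrable hp1')
    have h2 : P[ε ((i : ℤ) + 1) | ℱ i] =ᵐ[P] fun _ => 0 := by
      have h3 := condExp_indep_eq (hε.measurable ((i : ℤ) + 1)).comap_le (ℱ.le i)
        (measurable_iff_comap_le.2 le_rfl).stronglyMeasurable hind'
      rwa [(hε.identDistrib _).integral_eq, hε_mean] at h3
    have hAW : StronglyMeasurable[ℱ i] fun ω => A (W i ω) :=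
      A.continuous.comp_stronglyMeasurable (hWm i)
    have hAWi : Integrable (fun ω => A (W i ω)) P := A.integrable_comp (hWi i)
    have h4 : D i =ᵐ[P] ((fun ω => ρ ((i : ℤ) + 1) ω (W i ω)) + ε ((i : ℤ) + 1)) -
        fun ω => A (W i ω) := by
      filter_upwards [hWZ i, hWZ ((i : ℤ) + 1), hrec ((i : ℤ) + 1)] with ω h5 h6 h7
      rw [add_sub_cancel_right, ← h5] at h7
      simp only [hD, Pi.sub_apply, Pi.add_apply]
      rw [h6, h7]
    have h5 := condExp_sub (h1i.add hεi) hAWi (ℱ i)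
    have h6 := condExp_add h1i hεi (ℱ i)
    rw [condExp_of_stronglyMeasurable (ℱ.le i) hAW hAWi] at h5
    filter_upwards [condExp_congr_ae (m := ℱ i) h4, h5, h6, h1, h2] with ω g4 g5 g6 g1 g2
    rw [g4, g5, Pi.sub_apply, g6, Pi.add_apply, g1, g2]
    simp
  have hDid : ∀ i, IdentDistrib (fun ω => ‖D i ω‖) (fun ω => ‖D 0 ω‖) P P := fun i => by
    have hm : Measurable fun x : ℤ → B => ‖(x 1 - μ) - A (x 0 - μ)‖ := by
      have hm1 : Measurable fun x : ℤ → B => x 1 - μ := by fun_prop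
      have hm0 : Measurable fun x : ℤ → B => x 0 - μ := by fun_prop
      have hmA : Measurable fun x : ℤ → B => A (x 0 - μ) := A.continuous.measurable.comp hm0
      exact (hm1.sub hmA).norm
    have h1 := (hX_stat i).comp hm
    simp only [Function.comp_def, zero_add] at h1
    have h2 : ∀ j : ℕ, (fun ω => ‖D j ω‖) =ᵐ[P]
        fun ω => ‖X (1 + (j : ℤ)) ω - μ - A (X (j : ℤ) ω - μ)‖ := fun j => by
      filter_upwards [hWZ j, hWZ ((j : ℤ) + 1)] with ω h3 h4
      simp only [hD, h3, h4, add_comm (1 : ℤ)]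
    have h3 : ∀ j : ℕ, AEMeasurable (fun ω => ‖D j ω‖) P := fun j =>
      ((hDm j).mono (ℱ.le _)).norm.measurable.aemeasurable
    have h4 := (IdentDistrib.of_ae_eq (h3 i) (h2 i)).trans h1
    have h5 := IdentDistrib.of_ae_eq (h3 0) (h2 0)
    simp only [Nat.cast_zero, add_zero] at h5
    exact h4.trans h5.symm
  -- the two summable majorants, with `δ` shared between the martingale and the two boundary terms
  set η := δ * (1 - ‖A‖) / 3 with hη
  have hη0 : 0 < η := by
    have : 0 < 1 - ‖A‖ := by linarith
    positivity
  have s1 := summable_measureReal_max_martingale hp1 hpr hB hα0 hα1' hDm hDp hD0 hDid hη0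
  have hZp : Integrable (fun ω => ‖X 0 ω - μ‖ ^ p) P := by
    have h2 := ((memLp_congr_ae (hWZ 0)).1 (hWp 0)).integrable_norm_rpow hp0' ENNReal.ofReal_ne_top
    rwa [ENNReal.toReal_ofReal hp0.le] at h2
  have s2 := (summable_measureReal_tail hα0 hα1' hp1 hp2.le hη0 (hZm 0).norm
    (fun ω => norm_nonneg _) hZp).mul_left 2
  refine Summable.of_nonneg_of_le (fun n => by positivity) (fun n => ?_) (s1.add s2)
  set x : ℝ := ((n + 1 : ℕ) : ℝ) with hx
  have hx1 : 1 ≤ x := by rw [hx]; push_cast; linarith [Nat.cast_nonneg (α := ℝ) n]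
  have hx0 : 0 < x := by linarith
  set E1 := {ω | ∃ k ≤ n + 1, η * x ^ α ≤ ‖∑ i ∈ Finset.range k, D i ω‖} with hE1
  have hsub : P.real {ω | δ * x ^ α ≤ maxNormPartialSum X μ (n + 1) ω} ≤
      P.real (E1 ∪ ⋃ k ∈ Finset.range (n + 2), {ω | η * x ^ α ≤ ‖X (k : ℤ) ω - μ‖}) := by
    refine ENNReal.toReal_mono (measure_ne_top _ _) (measure_mono_ae ?_)
    filter_upwards [ae_all_iff.2 hWZ] with ω hω hmax
    obtain ⟨k, hk, hksup⟩ := Finset.exists_mem_eq_sup (Finset.Icc 1 (n + 1))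
      ⟨1, Finset.mem_Icc.2 ⟨le_rfl, by omega⟩⟩ fun k => ‖partialSum X k ω - (k : ℝ) • μ‖₊
    have hkn := (Finset.mem_Icc.1 hk).2
    have h1 : δ * x ^ α ≤ ‖partialSum X k ω - (k : ℝ) • μ‖ := by
      have h2 : δ * x ^ α ≤ maxNormPartialSum X μ (n + 1) ω := hmax
      rw [maxNormPartialSum, hksup] at h2
      exact h2
    have h2 : partialSum X k ω - (k : ℝ) • μ =
        ∑ i ∈ Finset.range k, (X ((i + 1 : ℕ) : ℤ) ω - μ) := by
      rw [Finset.sum_sub_distrib, partialSum, Finset.sum_const, Finset.card_range,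
        Nat.cast_smul_eq_nsmul, Finset.range_eq_Ico,
        Finset.sum_Ico_add' (fun i : ℕ => X (i : ℤ) ω) 0 k 1]
      rfl
    have h3 := one_sub_norm_mul_norm_sum_le hA1.le (fun i : ℕ => X (i : ℤ) ω - μ) k
    have h4 : ∑ i ∈ Finset.range k, (X ((i + 1 : ℕ) : ℤ) ω - μ - A (X (i : ℤ) ω - μ)) =
        ∑ i ∈ Finset.range k, D i ω :=
      Finset.sum_congr rfl fun i _ => by simp only [hD, hω]; push_cast; rfl
    rw [← h2, h4] at h3
    have h5 : 3 * (η * x ^ α) ≤ ‖∑ i ∈ Finset.range k, D i ω‖ + ‖X ((0 : ℕ) : ℤ) ω - μ‖ +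
        ‖X (k : ℤ) ω - μ‖ := by
      refine le_trans ?_ h3
      rw [hη]
      have := mul_le_mul_of_nonneg_left h1 (by linarith : 0 ≤ 1 - ‖A‖)
      linarith
    by_contra hcon
    obtain ⟨g1, g2⟩ := not_or.1 hcon
    have g1' := not_le.1 fun h => g1 ⟨k, hkn, h⟩
    have g2' : ∀ j < n + 2, ‖X (j : ℤ) ω - μ‖ < η * x ^ α := fun j hj => by
      by_contra hc
      exact g2 (Set.mem_biUnion (Finset.mem_coe.2 (Finset.mem_range.2 hj)) (not_lt.1 hc))
    have g3 := g2' 0 (by omega)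
    have g4 := g2' k (by omega)
    linarith
  have hunion : P.real (⋃ k ∈ Finset.range (n + 2), {ω | η * x ^ α ≤ ‖X (k : ℤ) ω - μ‖}) ≤
      2 * x * P.real {ω | η * x ^ α ≤ ‖X 0 ω - μ‖} := by
    refine (measureReal_biUnion_finset_le _ _).trans ?_
    have h1 : ∀ k : ℕ, P.real {ω | η * x ^ α ≤ ‖X (k : ℤ) ω - μ‖} =
        P.real {ω | η * x ^ α ≤ ‖X 0 ω - μ‖} := fun k =>
      congrArg ENNReal.toReal (((hZ k).comp measurable_norm).measure_mem_eq measurableSet_Ici)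
    simp only [h1, Finset.sum_const, Finset.card_range, nsmul_eq_mul]
    gcongr
    have : ((n + 2 : ℕ) : ℝ) = x + 1 := by rw [hx]; push_cast; ring
    linarith
  calc x ^ (α * p - 2) * P.real {ω | δ * x ^ α ≤ maxNormPartialSum X μ (n + 1) ω}
      ≤ x ^ (α * p - 2) * (P.real E1 + 2 * x * P.real {ω | η * x ^ α ≤ ‖X 0 ω - μ‖}) := by
        gcongr
        exact (hsub.trans (measureReal_union_le _ _)).trans (by gcongr)
    _ = _ := by
        rw [show α * p - 1 = α * p - 2 + 1 by ring, Real.rpow_add_one hx0.ne']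
        ring
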